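/- Let $n\ge s\ge 1$ and $s^*\ge 1$ be integers, $\epsilon>0$, and let $f:\mathbb R^n\to\mathbb R$ be differentiable and bounded below, with $B=\inf_x f(x)$ ($=\min_x f(x)$ when the minimum is attained). A vector is called $k$-sparse if it has at most $k$ nonzero entries. Let $\rho_2^+$ be the least real $\rho$ such that $f(y)\le f(x)+\langle\nabla f(x),y-x\rangle+\frac{\rho}{2}\|y-x\|_2^2$ for all $x,y$ with $y-x$ $2$-sparse, and let $\rho_{s+s^*}^-$ be the greatest $\rho\ge 0$ such that $f(y)\ge f(x)+\langle\nabla f(x),y-x\rangle+\frac{\rho}{2}\|y-x\|_2^2$ for all $x,y$ with $y-x$ $(s+s^*)$-sparse. Assume that both exist and that $\rho^-_{s+s^*}>0$, put $\widetilde\kappa=\rho_2^+/\rho_{s+s^*}^-$, and suppose that $s\ge s^*\max\{4\widetilde\kappa+7,\,12\widetilde\kappa+6\}$. For $R\subseteq[n]$ let $g_R(x)=f(x)+\frac{\rho_2^+}{2}\sum_{i\in R}x_i^2$. The Adaptively Regularized Hard Thresholding algorithm $\mathrm{ARHT}(s,\epsilon)$ is composed of the following routines (upper limits of loops are rounded up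 to integers, and "$\log$" is the natural logarithm). $\mathrm{Core}(\mathrm{opt},\delta)$: set $R=[n]$, $S=[s]$, $x=\operatorname{argmin}_{\mathrm{supp}(x)\subseteq S}g_R(x)$. Repeat $2s\log\frac{f(0)-B}{\delta}$ times: if $\min_{\mathrm{supp}(z)\subseteq S}f(z)\le\mathrm{opt}$, return $\operatorname{argmin}_{\mathrm{supp}(z)\subseteq S}f(z)$; otherwise let $i\in\operatorname{argmax}_{i\in[n]}|\nabla_i g_R(x)|$, $j\in\operatorname{argmin}_{j\in S}|x_j|$, $S'=(S\cup\{i\})\setminus\{j\}$, $x'=\operatorname{argmin}_{\mathrm{supp}(z)\subseteq S'}g_R(z)$; if $g_R(x)-g_R(x')\ge\frac1s(g_R(x)-\mathrm{opt})$, replace $(S,x)$ by $(S',x')$; otherwise sample $k\in R$ with probability proportional to $x_k^2$, remove $k$ from $R$, and set $x=\operatorname{argmin}_{\mathrm{supp}(z)\subseteq S}g_R(z)$ for the new $R$. Finally return $x$. Ties are broken arbitrarily, and if $x$ vanishes on $R$ then $k\in[n]$ is drawn from an arbitrary distribution. $\mathrm{Robust}(\mathrm{opt},\delta)$: run $\mathrm{Core}(\mathrm{opt},\delta)$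 independently $5\log\bigl(6n\log\frac{f(0)-B}{\delta}\bigr)$ times and return the vector with the smallest value of $f$ among the results and $0$. $\mathrm{ARHT}(s,\epsilon)$: set $l=B$, $b=0$, $r=f(0)$. While $r-l>\epsilon$: let $m=\frac{l+r}{2}$ and $x=\mathrm{Robust}(m,\epsilon/3)$; if $f(x)>m+\epsilon/3$ set $l=m$, otherwise set $b=x$ and $r=f(x)$. Return $b$. Then for every $s^*$-sparse $x^*\in\mathbb R^n$, with probability at least $1-\frac1n$, $\mathrm{ARHT}(s,\epsilon)$ returns an $s$-sparse vector $x$ with $f(x)\le f(x^*)+\epsilon$. Moreover, the total number of iterations of all its loops is always at most $C\,s\,L^2\log(nL)$, where $L=\max\{1,\log\frac{f(0)-B}{\epsilon}\}$ (with $L=1$ if $f(0)=B$) and $C$ is an absolute constant; that is, it is $O\bigl(s\log^2\frac{f(0)-B}{\epsilon}\,\log\bigl(n\log\frac{f(0)-B}{\epsilon}\bigr)\bigr)$ as soon as $\log\frac{f(0)-B}{\epsilon}\ge 1$. -/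

import Mathlib

open scoped Gradient

noncomputable section

namespace ARHT

/-- Euclidean space `ℝⁿ`. -/
abbrev E (n : ℕ) : Type := EuclideanSpace ℝ (Fin n)

/-- The support of a vector. -/
def supp {n : ℕ} (x : E n) : Finset (Fin n) :=
  Finset.univ.filter fun i => x i ≠ 0

/-- `x` is `s`-sparse: it has at most `s` nonzero entries. -/
def IsSparse {n : ℕ} (s : ℕ) (x : E n) : Prop := (supp x).card ≤ s

/-- The quadratic upper bound of restricted smoothness at sparsity level `s`. -/
def RestrictedSmooth {n : ℕ} (f : E n → ℝ) (s : ℕ) (ρ : ℝ) : Prop :=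
  ∀ x y : E n, IsSparse s (y - x) →
    f y ≤ f x + inner ℝ (∇ f x) (y - x) + ρ / 2 * ‖y - x‖ ^ 2

/-- The quadratic lower bound of restricted strong convexity at sparsity level `s`. -/
def RestrictedStronglyConvex {n : ℕ} (f : E n → ℝ) (s : ℕ) (ρ : ℝ) : Prop :=
  ∀ x y : E n, IsSparse s (y - x) →
    f x + inner ℝ (∇ f x) (y - x) + ρ / 2 * ‖y - x‖ ^ 2 ≤ f y

/-- `ρ` is the restricted smoothness constant `ρ_s⁺` of `f`: the least admissible real. -/
def IsRSSConstant {n : ℕ} (f : E n → ℝ) (s : ℕ) (ρ : ℝ) : Prop :=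
  IsLeast {c : ℝ | RestrictedSmooth f s c} ρ

/-- `ρ` is the restricted strong convexity constant `ρ_s⁻` of `f`: the greatest admissible
nonnegative real. -/
def IsRSCConstant {n : ℕ} (f : E n → ℝ) (s : ℕ) (ρ : ℝ) : Prop :=
  IsGreatest {c : ℝ | 0 ≤ c ∧ RestrictedStronglyConvex f s c} ρ

/-- `x` is an `S`-restricted minimizer of `h`. -/
def IsRestrictedMinimizer {n : ℕ} (h : E n → ℝ) (S : Finset (Fin n)) (x : E n) : Prop :=
  supp x ⊆ S ∧ ∀ y : E n, supp y ⊆ S → h x ≤ h y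

/-- `argmin {h x | supp x ⊆ S}`: an `S`-restricted minimizer of `h` (if there is one). -/
def argminOn {n : ℕ} (h : E n → ℝ) (S : Finset (Fin n)) : E n :=
  Classical.epsilon (IsRestrictedMinimizer h S)

/-- The regularized objective `g_R x = f x + (ρ / 2) ‖x_R‖²`. -/
def reg {n : ℕ} (f : E n → ℝ) (ρ : ℝ) (R : Finset (Fin n)) (x : E n) : ℝ :=
  f x + ρ / 2 * ∑ i ∈ R, x i ^ 2

/-- The state of the core routine: current support set, set of regularized coordinates,
current solution. -/
structure State (n : ℕ) where
  S : Finset (Fin n)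
  R : Finset (Fin n)
  x : E n

/-- What the pseudocode of the core routine leaves open: how ties are broken in the two `argmax` /
`argmin` over coordinates, and what is drawn when "sample `i ∈ R` proportionally to `x_i ^ 2`" is
meaningless because `x` vanishes on `R`. -/
structure Conventions (n : ℕ) where
  pickInsert : State n → Finset (Fin n) → Fin n
  pickInsert_mem : ∀ σ A, A.Nonempty → pickInsert σ A ∈ A
  pickRemove : State n → Finset (Fin n) → Fin n
  pickRemove_mem : ∀ σ A, A.Nonempty → pickRemove σ A ∈ A
  degenerate : State n → PMF (Fin n)

open Classical in
/-- The coordinates in `argmax_{i ∈ [n]} |∇_i h(x)|`. -/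
def insertCandidates {n : ℕ} (h : E n → ℝ) (x : E n) : Finset (Fin n) :=
  Finset.univ.filter fun i => ∀ k : Fin n, |(∇ h x) k| ≤ |(∇ h x) i|

open Classical in
/-- The coordinates in `argmin_{j ∈ S} |x_j|`. -/
def removeCandidates {n : ℕ} (S : Finset (Fin n)) (x : E n) : Finset (Fin n) :=
  S.filter fun j => ∀ k ∈ S, |x j| ≤ |x k|

/-- The weights `x_i ^ 2` for `i ∈ R`, and `0` off `R`. -/
def sampleWeight {n : ℕ} (R : Finset (Fin n)) (x : E n) (i : Fin n) : ENNReal :=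
  if i ∈ R then ENNReal.ofReal (x i ^ 2) else 0

theorem tsum_sampleWeight_ne_zero {n : ℕ} {R : Finset (Fin n)} {x : E n}
    (h : ∃ i ∈ R, x i ≠ 0) : ∑' i, sampleWeight R x i ≠ 0 := by
  obtain ⟨i, hi, hx⟩ := h
  rw [tsum_fintype]
  intro h0
  have h1 := (Finset.sum_eq_zero_iff.mp h0) i (Finset.mem_univ i)
  rw [sampleWeight, if_pos hi, ENNReal.ofReal_eq_zero] at h1
  have : 0 < x i ^ 2 := by positivity
  linarith

theorem tsum_sampleWeight_ne_top {n : ℕ} (R : Finset (Fin n)) (x : E n) :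
    ∑' i, sampleWeight R x i ≠ ⊤ := by
  rw [tsum_fintype]
  refine (ENNReal.sum_lt_top.mpr fun i _ => ?_).ne
  unfold sampleWeight
  split
  · exact ENNReal.ofReal_lt_top
  · exact ENNReal.zero_lt_top

open Classical in
/-- The law of an index `i ∈ R` sampled with probability proportional to `x_i ^ 2`. -/
def sampleLaw {n : ℕ} (K : Conventions n) (σ : State n) : PMF (Fin n) :=
  if h : ∃ i ∈ σ.R, σ.x i ≠ 0 then
    PMF.normalize (sampleWeight σ.R σ.x) (tsum_sampleWeight_ne_zero h)
      (tsum_sampleWeight_ne_top σ.R σ.x)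
  else K.degenerate σ

/-- The initial state of the core routine: `S⁰ = [s]`, `R⁰ = [n]`, and the minimizer of the
regularized objective. -/
def coreInit {n : ℕ} (f : E n → ℝ) (ρ : ℝ) (s : ℕ) : State n :=
  let S₀ : Finset (Fin n) := Finset.univ.filter fun i => i.val < s
  ⟨S₀, Finset.univ, argminOn (reg f ρ Finset.univ) S₀⟩

open Classical in
/-- The part of an iteration of the core routine that follows the test for an early return. -/
def coreStep {n : ℕ} (K : Conventions n) (f : E n → ℝ) (ρ : ℝ) (s : ℕ) (opt : ℝ)
    (σ : State n) : PMF (State n) :=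
  let g := reg f ρ σ.R
  let i := K.pickInsert σ (insertCandidates g σ.x)
  let j := K.pickRemove σ (removeCandidates σ.S σ.x)
  let S' := (insert i σ.S).erase j
  let x' := argminOn g S'
  if g σ.x - g x' < 1 / (s : ℝ) * (g σ.x - opt) then
    (sampleLaw K σ).map fun k =>
      ⟨σ.S, σ.R.erase k, argminOn (reg f ρ (σ.R.erase k)) σ.S⟩
  else
    PMF.pure ⟨S', σ.R, x'⟩

open Classical in
/-- The loop of the core routine with a given number of iterations left. The second component of
the result is the number of iterations that are executed. -/
def coreLoop {n : ℕ} (K : Conventions n) (f : E n → ℝ) (ρ : ℝ) (s : ℕ) (opt : ℝ) :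
    ℕ → State n → PMF (E n × ℕ)
  | 0, σ => PMF.pure (σ.x, 0)
  | T + 1, σ =>
    if f (argminOn f σ.S) ≤ opt then PMF.pure (argminOn f σ.S, 1)
    else (coreStep K f ρ s opt σ).bind fun σ' =>
      (coreLoop K f ρ s opt T σ').map fun p => (p.1, p.2 + 1)

/-- The infimum of `f`. -/
def minValue {n : ℕ} (f : E n → ℝ) : ℝ := ⨅ x, f x

/-- The core routine, for the guess `opt` and accuracy `ε`. -/
def core {n : ℕ} (K : Conventions n) (f : E n → ℝ) (ρ : ℝ) (s : ℕ) (opt ε : ℝ) :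
    PMF (E n × ℕ) :=
  coreLoop K f ρ s opt ⌈2 * (s : ℝ) * Real.log ((f 0 - minValue f) / ε)⌉₊ (coreInit f ρ s)

open Classical in
/-- `z` remaining independent runs of the core routine, keeping the best solution so far. The
second component is the number of iterations of this loop and of the loops inside it. -/
def robustLoop {n : ℕ} (K : Conventions n) (f : E n → ℝ) (ρ : ℝ) (s : ℕ) (opt ε : ℝ) :
    ℕ → E n → PMF (E n × ℕ)
  | 0, xret => PMF.pure (xret, 0)
  | z + 1, xret =>
    (core K f ρ s opt ε).bind fun p =>
      (robustLoop K f ρ s opt ε z (if f p.1 < f xret then p.1 else xret)).map fun q =>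
        (q.1, p.2 + 1 + q.2)

/-- The boosted routine, for the guess `opt`, accuracy `ε` and lower bound `B`. -/
def robust {n : ℕ} (K : Conventions n) (f : E n → ℝ) (ρ : ℝ) (s : ℕ) (opt ε B : ℝ) :
    PMF (E n × ℕ) :=
  robustLoop K f ρ s opt ε
    ⌈5 * Real.log (6 * (n : ℝ) * Real.log ((f 0 - B) / ε))⌉₊ 0

/-- A bound on the number of remaining iterations of the binary search, used only to see that it
terminates. -/
def gapMeasure (ε L : ℝ) : ℕ := ⌈Real.logb (6 / 5) (max (L / ε) 1)⌉₊

theorem gapMeasure_lt {ε L L' : ℝ} (hε : 0 < ε) (hL : ε < L) (hL' : L' ≤ 5 / 6 * L) :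
    gapMeasure ε L' < gapMeasure ε L := by
  have h1 : 1 < L / ε := (one_lt_div hε).mpr hL
  have hb : (1 : ℝ) < 6 / 5 := by norm_num
  unfold gapMeasure
  rw [max_eq_left h1.le]
  have hpos : 0 < Real.logb (6 / 5) (L / ε) := Real.logb_pos hb h1
  rcases le_total (L' / ε) 1 with h | h
  · rw [max_eq_right h, Real.logb_one, Nat.ceil_zero]
    exact Nat.ceil_pos.mpr hpos
  · rw [max_eq_left h]
    have h2 : Real.logb (6 / 5) (L' / ε) ≤ Real.logb (6 / 5) (L / ε) - 1 := by
      have h3 : L' / ε ≤ (L / ε) / (6 / 5) := by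
        rw [div_div, div_le_div_iff₀ hε (by positivity)]
        nlinarith
      have h4 := Real.logb_le_logb_of_le hb (by linarith : 0 < L' / ε) h3
      have h5 := Real.logb_div (b := 6 / 5) (x := L / ε) (y := 6 / 5) (by linarith) (by norm_num)
      rw [Real.logb_self_eq_one hb] at h5
      linarith
    have h5 := Nat.ceil_mono h2
    rw [Nat.ceil_sub_one] at h5
    have h6 := Nat.ceil_pos.mpr hpos
    omega

open Classical in
/-- The binary search `while r - l > ε`, with current bracket `[l, r]` and best solution `b`. The
second component is the number of iterations of this loop and of all loops inside it. -/
def searchLoop {n : ℕ} (K : Conventions n) (f : E n → ℝ) (ρ : ℝ) (s : ℕ) (ε : ℝ) (hε : 0 < ε)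
    (B l r : ℝ) (b : E n) : PMF (E n × ℕ) :=
  if hgap : r - l > ε then
    (robust K f ρ s ((l + r) / 2) (ε / 3) B).bind fun p =>
      if hx : f p.1 > (l + r) / 2 + ε / 3 then
        (searchLoop K f ρ s ε hε B ((l + r) / 2) r b).map fun q => (q.1, p.2 + 1 + q.2)
      else
        (searchLoop K f ρ s ε hε B l (f p.1) p.1).map fun q => (q.1, p.2 + 1 + q.2)
  else PMF.pure (b, 0)
termination_by gapMeasure ε (r - l)
decreasing_by
  · exact gapMeasure_lt hε hgap (by linarith)
  · exact gapMeasure_lt hε hgap (by linarith)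

/-- Adaptively regularized hard thresholding: the joint law of the returned solution and of the
total number of iterations (of all its loops), for the regularization parameter `ρ`, sparsity `s`
and accuracy `ε`. -/
def arht {n : ℕ} (K : Conventions n) (f : E n → ℝ) (ρ : ℝ) (s : ℕ) (ε : ℝ) (hε : 0 < ε) :
    PMF (E n × ℕ) :=
  searchLoop K f ρ s ε hε (minValue f) (minValue f) (f 0) 0

end ARHT

end

/-!
Write `κ = ρ / ρ'` for the ratio of the smoothness and the strong convexity constant, so `κ ≥ 1`,
and fix a sparse comparison vector `z`.

*Progress or sampling.* Let `x` minimize `g_R` on a support set `S` of size `s`, and suppose that no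
vector supported on `S` reaches a target `opt ≥ f z`. Swapping the coordinate of largest gradient
into `S` and the smallest entry `x_j` out of it gains at least `|∇_i g_R|² / (4 ρ) - ρ x_j²`
(`exists_reg_le_of_swap`), while strong convexity between `x` and `z` bounds the gap by the gradient
on `supp z \ S` and by the masses `P` and `Q` of `x` on `R \ supp z` and `R ∩ supp z`
(`sub_le_of_restrictedStronglyConvex`). As long as fewer than `s / 2` coordinates have left `R`,
`x_j²` is at most the average of at least `4 s / 9` summands of `P`; moreover
`f z < f x` forces the gradient to be large when `P` is. Hence an iteration that does not shrink
the gap `g_R x - opt` by the factor `1 - 1 / s` satisfies `P + Q < (3 κ + 3) Q`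
(`sum_sq_lt_of_no_progress`): sampling proportionally to `x_k²` then hits `supp z` with probability
more than `1 / (3 κ + 3)`.

*The core routine.* Only `|supp z|` coordinates of `supp z` can leave `R`, so
`(3 κ + 3) |R ∩ supp z| + |Rᶜ|` is a supermartingale. It starts at no more than
`(3 κ + 3) s* ≤ s / 3`, so `|Rᶜ|` reaches `s / 2` with probability at most `2 / 3`. Otherwise
all but `s` of the `2 s log (D / δ)` iterations, with `D = f 0 - inf f`, contract the gap, which is
at most `D` initially, and the final gap is at most `δ` (`coreLoop_failure`, `core_failure`).

*Boosting and binary search.* Since `2 / 3 ≤ exp (-1 / 5)`, the repetitions reduce the failure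
probability to `1 / (6 n log (3 D / ε))`. The binary search makes at most `6 log (D / ε) + 1`
iterations, each shrinking the bracket by the factor `5 / 6`, and it can go wrong only in a call
whose target is at least `f z`; a union bound gives `1 / n` (`searchLoop_failure`,
`arht_failure`). The iteration count is the product of the bounds for the three nested loops.
-/

noncomputable section

namespace ARHT

/-! ### Restricted minimizers -/

theorem supp_subset_iff {n : ℕ} {x : E n} {S : Finset (Fin n)} :
    supp x ⊆ S ↔ ∀ i, i ∉ S → x i = 0 := by
  simp only [supp, Finset.subset_iff, Finset.mem_filter, Finset.mem_univ, true_and]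
  exact forall_congr' fun i => not_imp_comm

theorem isSparse_of_supp_subset {n s : ℕ} {x : E n} {S : Finset (Fin n)} (h : supp x ⊆ S)
    (hS : S.card ≤ s) : IsSparse s x :=
  (Finset.card_le_card h).trans hS

theorem supp_sub_subset {n : ℕ} {x y : E n} {S T : Finset (Fin n)} (hx : supp x ⊆ S)
    (hy : supp y ⊆ T) : supp (x - y) ⊆ S ∪ T := by
  rw [supp_subset_iff] at *
  intro i hi
  rw [Finset.notMem_union] at hi
  simp [hx i hi.1, hy i hi.2]

theorem isClosed_supp_subset {n : ℕ} (S : Finset (Fin n)) : IsClosed {x : E n | supp x ⊆ S} := by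
  simp only [supp_subset_iff, Set.ofPred_forall]
  exact isClosed_iInter fun i => isClosed_iInter fun _ => isClosed_eq (by fun_prop) (by fun_prop)

theorem supp_zero_subset {n : ℕ} (S : Finset (Fin n)) : supp (0 : E n) ⊆ S := by
  simp [supp_subset_iff]

/-- A continuous function that dominates a positive definite quadratic polynomial on a coordinate
subspace is coercive there, so it has a restricted minimizer. -/
theorem exists_isRestrictedMinimizer {n : ℕ} {h : E n → ℝ} (hc : Continuous h)
    {S : Finset (Fin n)} {a : E n} {b c : ℝ} (hcpos : 0 < c)
    (hlow : ∀ y, supp y ⊆ S → b + inner ℝ a y + c * ‖y‖ ^ 2 ≤ h y) :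
    ∃ x, IsRestrictedMinimizer h S x := by
  have hev : ∀ᶠ x in Filter.cocompact (E n) ⊓ Filter.principal {x : E n | supp x ⊆ S},
      h 0 ≤ h x := by
    rw [Filter.eventually_inf_principal]
    filter_upwards [(tendsto_norm_cocompact_atTop (E := E n)).eventually_ge_atTop
      (max 1 ((‖a‖ + |h 0 - b|) / c))] with x hx hxS
    have h1 : 1 ≤ ‖x‖ := (le_max_left _ _).trans hx
    have h2 : (‖a‖ + |h 0 - b|) / c ≤ ‖x‖ := (le_max_right _ _).trans hx
    rw [div_le_iff₀ hcpos] at h2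
    have h3 := (abs_le.mp (abs_real_inner_le_norm a x)).1
    have h4 := hlow x hxS
    have h5 := le_abs_self (h 0 - b)
    have h6 := abs_nonneg (h 0 - b)
    nlinarith
  obtain ⟨x, hx, hmin⟩ := hc.continuousOn.exists_isMinOn' (isClosed_supp_subset S)
    (supp_zero_subset S) hev
  exact ⟨x, hx, fun y hy => hmin hy⟩

theorem isRestrictedMinimizer_argminOn {n : ℕ} {h : E n → ℝ} {S : Finset (Fin n)}
    (hex : ∃ x, IsRestrictedMinimizer h S x) : IsRestrictedMinimizer h S (argminOn h S) :=
  Classical.epsilon_spec hex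

theorem RestrictedStronglyConvex.exists_isRestrictedMinimizer_reg {n s : ℕ} {f : E n → ℝ}
    {ρ ρ' : ℝ} (hf : Differentiable ℝ f) (hconv : RestrictedStronglyConvex f s ρ)
    (hρ : 0 < ρ) (hρ' : 0 ≤ ρ') {S : Finset (Fin n)} (hS : S.card ≤ s) (R : Finset (Fin n)) :
    ∃ x, IsRestrictedMinimizer (reg f ρ' R) S x := by
  have hcf := hf.continuous
  refine exists_isRestrictedMinimizer (a := ∇ f 0) (b := f 0) (c := ρ / 2) ?_ (by positivity) ?_
  · unfold reg
    fun_prop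
  · intro y hy
    have h1 := hconv 0 y (by simpa using isSparse_of_supp_subset hy hS)
    have h2 : 0 ≤ ρ' / 2 * ∑ i ∈ R, y i ^ 2 := by positivity
    simp only [sub_zero] at h1
    simp only [reg]
    linarith

theorem reg_empty {n : ℕ} (f : E n → ℝ) (ρ : ℝ) : reg f ρ ∅ = f := by
  ext x; simp [reg]

theorem le_reg {n : ℕ} (f : E n → ℝ) {ρ : ℝ} (hρ : 0 ≤ ρ) (R : Finset (Fin n)) (x : E n) :
    f x ≤ reg f ρ R x := by
  have : 0 ≤ ρ / 2 * ∑ i ∈ R, x i ^ 2 := by positivity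
  simp only [reg]; linarith

theorem reg_mono {n : ℕ} (f : E n → ℝ) {ρ : ℝ} (hρ : 0 ≤ ρ) {R R' : Finset (Fin n)} (h : R ⊆ R')
    (x : E n) : reg f ρ R x ≤ reg f ρ R' x := by
  have := Finset.sum_le_sum_of_subset_of_nonneg h (f := fun i => x i ^ 2)
    fun i _ _ => sq_nonneg _
  simp only [reg]; gcongr

/-! ### Gradients in coordinates -/

theorem hasDerivAt_along_coordinate {n : ℕ} {h : E n → ℝ} {x : E n} (hh : DifferentiableAt ℝ h x)
    (i : Fin n) :
    HasDerivAt (fun t : ℝ => h (x + t • EuclideanSpace.single i 1)) ((∇ h x) i) 0 := by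
  have h1 := hh.hasGradientAt.hasFDerivAt
  have h2 : HasDerivAt (fun t : ℝ => x + t • EuclideanSpace.single i (1 : ℝ))
      (EuclideanSpace.single i 1) 0 := by
    simpa using ((hasDerivAt_id (0 : ℝ)).smul_const (EuclideanSpace.single i (1 : ℝ))).const_add x
  refine (h1.comp_hasDerivAt_of_eq (0 : ℝ) h2 (by simp)).congr_deriv ?_
  rw [InnerProductSpace.toDual_apply_apply, EuclideanSpace.inner_single_right]
  simp

/-- A restricted minimizer is stationary in every coordinate of its support set. -/
theorem IsRestrictedMinimizer.gradient_eq_zero {n : ℕ} {h : E n → ℝ} {S : Finset (Fin n)}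
    {x : E n} (hx : IsRestrictedMinimizer h S x) (hh : DifferentiableAt ℝ h x) {i : Fin n}
    (hi : i ∈ S) : (∇ h x) i = 0 := by
  refine IsLocalMin.hasDerivAt_eq_zero (Filter.Eventually.of_forall fun t => ?_)
    (hasDerivAt_along_coordinate hh i)
  rw [zero_smul, add_zero]
  refine hx.2 _ (supp_subset_iff.mpr fun k hk => ?_)
  have hki : k ≠ i := fun e => hk (e ▸ hi)
  simp [supp_subset_iff.mp hx.1 k hk, hki]

theorem differentiable_reg {n : ℕ} {f : E n → ℝ} (hf : Differentiable ℝ f) (ρ : ℝ)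
    (R : Finset (Fin n)) : Differentiable ℝ (reg f ρ R) := by
  unfold reg
  fun_prop

theorem gradient_reg_apply {n : ℕ} {f : E n → ℝ} (hf : Differentiable ℝ f) (ρ : ℝ)
    (R : Finset (Fin n)) (x : E n) (i : Fin n) :
    (∇ (reg f ρ R) x) i = (∇ f x) i + if i ∈ R then ρ * x i else 0 := by
  refine (hasDerivAt_along_coordinate (differentiable_reg hf ρ R x) i).unique ?_
  have h1 : ∀ k ∈ R, HasDerivAt
      (fun t : ℝ => (x + t • EuclideanSpace.single i (1 : ℝ) : E n) k ^ 2)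
      (if k = i then 2 * x i else 0) 0 := by
    intro k _
    have h2 : HasDerivAt (fun t : ℝ => (x k + t * if k = i then 1 else 0) ^ 2)
        (if k = i then 2 * x i else 0) 0 := by
      refine ((((hasDerivAt_id (0 : ℝ)).mul_const (if k = i then (1 : ℝ) else 0)).const_add
        (x k)).fun_pow 2).congr_deriv ?_
      split_ifs with h <;> simp [h]
    convert h2 using 3
    simp
  have h3 := (hasDerivAt_along_coordinate (hf x) i).fun_add
    ((HasDerivAt.fun_sum h1).const_mul (ρ / 2))
  refine h3.congr_deriv ?_
  rw [Finset.sum_ite_eq' R i]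
  split_ifs <;> ring

/-! ### The dichotomy between progress and sampling -/

/-- Strong convexity between a minimizer `x` of the regularized objective and a vector `z`. The
gradient of `f` differs from that of the regularized objective by `-ρ x` on `R`, which contributes
the negative term off the support of `z`. -/
theorem sub_le_of_restrictedStronglyConvex {n s : ℕ} {f : E n → ℝ} {ρ ρ' : ℝ}
    (hf : Differentiable ℝ f) (hconv : RestrictedStronglyConvex f s ρ') (hρ' : 0 < ρ')
    {S R : Finset (Fin n)} {x z : E n}
    (hx : IsRestrictedMinimizer (reg f ρ R) S x) (hz : IsSparse s (z - x)) :
    f x - f z ≤ 1 / (2 * ρ') * ∑ i ∈ supp z \ S, (∇ (reg f ρ R) x) i ^ 2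
      - ρ * ∑ i ∈ R \ supp z, x i ^ 2 + ρ ^ 2 / (2 * ρ') * ∑ i ∈ R ∩ supp z, x i ^ 2 := by
  have h1 := hconv x z hz
  rw [PiLp.inner_apply, EuclideanSpace.norm_sq_eq] at h1
  have h2 : -(1 / (2 * ρ') * ∑ i ∈ supp z \ S, (∇ (reg f ρ R) x) i ^ 2)
      + ρ * ∑ i ∈ R \ supp z, x i ^ 2 - ρ ^ 2 / (2 * ρ') * ∑ i ∈ R ∩ supp z, x i ^ 2 ≤
      ∑ i, inner ℝ ((∇ f x) i) ((z - x) i) + ρ' / 2 * ∑ i, ‖(z - x) i‖ ^ 2 := by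
    rw [← Finset.univ_inter (supp z \ S), ← Finset.univ_inter (R \ supp z),
      ← Finset.univ_inter (R ∩ supp z), ← Finset.sum_ite_mem, ← Finset.sum_ite_mem,
      ← Finset.sum_ite_mem, Finset.mul_sum, Finset.mul_sum, Finset.mul_sum, Finset.mul_sum,
      ← Finset.sum_neg_distrib, ← Finset.sum_add_distrib, ← Finset.sum_sub_distrib,
      ← Finset.sum_add_distrib]
    refine Finset.sum_le_sum fun i _ => ?_
    have hg := gradient_reg_apply hf ρ R x i
    have hS : i ∈ S → (∇ (reg f ρ R) x) i = 0 :=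
      hx.gradient_eq_zero (differentiable_reg hf ρ R x)
    have hS' := supp_subset_iff.mp hx.1 i
    have hT : i ∉ supp z → z i = 0 := supp_subset_iff.mp le_rfl i
    -- completing the square
    have hsq : ∀ a b : ℝ, -(1 / (2 * ρ') * a ^ 2) ≤ a * b + ρ' / 2 * b ^ 2 := by
      intro a b
      have : a * b + ρ' / 2 * b ^ 2 + 1 / (2 * ρ') * a ^ 2 = (ρ' * b + a) ^ 2 / (2 * ρ') := by
        field_simp
        ring
      have : 0 ≤ (ρ' * b + a) ^ 2 / (2 * ρ') := by positivity
      linarith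
    have hi : inner ℝ ((∇ f x) i) ((z - x) i) = (∇ f x) i * (z i - x i) := by
      simp [mul_comm]
    have hn : ‖(z - x) i‖ ^ 2 = (z i - x i) ^ 2 := by simp
    rw [hi, hn]
    simp only [Finset.mem_sdiff, Finset.mem_inter]
    generalize (∇ f x) i = a at *
    by_cases h1 : i ∈ S
    · rw [hS h1] at hg
      by_cases h2 : i ∈ R
      · rw [if_pos h2] at hg
        obtain rfl : a = -(ρ * x i) := by linarith
        by_cases h3 : i ∈ supp z
        · have := hsq (-(ρ * x i)) (z i - x i)
          simp only [h1, h2, h3, not_true, and_false, if_false, and_true, if_true]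
          have e : ρ ^ 2 / (2 * ρ') * x i ^ 2 = 1 / (2 * ρ') * (-(ρ * x i)) ^ 2 := by ring
          linarith
        · have : 0 ≤ ρ' / 2 * x i ^ 2 := by positivity
          simp only [h1, h2, h3, hT h3, not_true, and_false, if_false, and_true, if_true,
            not_false_eq_true]
          linarith
      · rw [if_neg h2] at hg
        obtain rfl : a = 0 := by linarith
        have : 0 ≤ ρ' / 2 * (z i - x i) ^ 2 := by positivity
        simp only [h1, h2, not_true, and_false, false_and, if_false]
        linarith
    · rw [hS' h1] at hg ⊢
      have := hsq a (z i)
      by_cases h3 : i ∈ supp z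
      · simp only [mul_zero, ite_self, add_zero] at hg
        simpa [h1, h3, hg] using this
      · simp [h3, hT h3]
  linarith

/-- Moving along the gradient in a new coordinate `i` and erasing coordinate `j`. -/
theorem exists_reg_le_of_swap {n : ℕ} {f : E n → ℝ} {ρ : ℝ} (hf : Differentiable ℝ f)
    (hsm : RestrictedSmooth f 2 ρ) (hρ : 0 < ρ) {S R : Finset (Fin n)} {x : E n}
    (hx : IsRestrictedMinimizer (reg f ρ R) S x) {i j : Fin n} (hi : i ∉ S) (hj : j ∈ S) :
    ∃ y, supp y ⊆ (insert i S).erase j ∧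
      reg f ρ R y ≤ reg f ρ R x - (∇ (reg f ρ R) x) i ^ 2 / (4 * ρ) + ρ * x j ^ 2 := by
  have hij : i ≠ j := fun e => hi (e ▸ hj)
  have hxi : x i = 0 := supp_subset_iff.mp hx.1 i hi
  have hgi := gradient_reg_apply hf ρ R x i
  have hgj := gradient_reg_apply hf ρ R x j
  rw [hx.gradient_eq_zero (differentiable_reg hf ρ R x) hj] at hgj
  rw [hxi, mul_zero, ite_self, add_zero] at hgi
  set d := (∇ (reg f ρ R) x) i
  set v : E n := EuclideanSpace.single i (-(d / (2 * ρ))) + EuclideanSpace.single j (-(x j))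
  have hv : ∀ k, v k = (if k = i then -(d / (2 * ρ)) else 0) + if k = j then -(x j) else 0 := by
    intro k; simp [v]
  refine ⟨x + v, supp_subset_iff.mpr fun k hk => ?_, ?_⟩
  · by_cases hkj : k = j
    · subst hkj
      simp [hv, hij.symm]
    · have hk' : k ∉ insert i S := fun h => hk (Finset.mem_erase.mpr ⟨hkj, h⟩)
      rw [Finset.mem_insert, not_or] at hk'
      simp [hv, hk'.1, hkj, supp_subset_iff.mp hx.1 k hk'.2]
  · have hsp : IsSparse 2 (x + v - x) := by
      rw [add_sub_cancel_left]
      refine isSparse_of_supp_subset (S := {i, j}) (supp_subset_iff.mpr fun k hk => ?_)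
        Finset.card_le_two
      simp only [Finset.mem_insert, Finset.mem_singleton, not_or] at hk
      simp [hv, hk.1, hk.2]
    have h1 := hsm x (x + v) hsp
    have hinner : inner ℝ (∇ f x) v = -(d / (2 * ρ)) * d + -(x j) * (∇ f x) j := by
      rw [inner_add_right, EuclideanSpace.inner_single_right, EuclideanSpace.inner_single_right,
        hgi]
      rfl
    have hnorm : ‖v‖ ^ 2 = (d / (2 * ρ)) ^ 2 + x j ^ 2 := by
      have : ∀ k, ‖v k‖ ^ 2 = (if k = i then (d / (2 * ρ)) ^ 2 else 0) +
          if k = j then x j ^ 2 else 0 := by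
        intro k
        rw [hv, Real.norm_eq_abs, sq_abs]
        by_cases hk : k = i
        · simp [hk, hij]
        · by_cases hk' : k = j <;> simp [hk, hk', hij.symm]
      rw [EuclideanSpace.norm_sq_eq, Finset.sum_congr rfl fun k _ => this k,
        Finset.sum_add_distrib]
      simp
    have hsum : ∑ k ∈ R, (x + v) k ^ 2 = ∑ k ∈ R, x k ^ 2 +
        ((if i ∈ R then (d / (2 * ρ)) ^ 2 else 0) + if j ∈ R then -(x j ^ 2) else 0) := by
      have : ∀ k, (x + v) k ^ 2 = x k ^ 2 + ((if k = i then (d / (2 * ρ)) ^ 2 else 0) +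
          if k = j then -(x j ^ 2) else 0) := by
        intro k
        rw [PiLp.add_apply, hv]
        by_cases hk : k = i
        · subst hk
          simp [hxi, hij]
        · by_cases hk' : k = j
          · subst hk'
            simp [hk]
          · simp [hk, hk']
      rw [Finset.sum_congr rfl fun k _ => this k, Finset.sum_add_distrib,
        Finset.sum_add_distrib, Finset.sum_ite_eq', Finset.sum_ite_eq']
    rw [add_sub_cancel_left, hinner, hnorm] at h1
    have e1 : d / (2 * ρ) * d = 2 * ρ * (d / (2 * ρ)) ^ 2 := by field_simp
    have e2 : d ^ 2 / (4 * ρ) = ρ * (d / (2 * ρ)) ^ 2 := by field_simp; ring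
    have p1 : 0 ≤ ρ * (d / (2 * ρ)) ^ 2 := by positivity
    have p2 : 0 ≤ ρ * x j ^ 2 := by positivity
    simp only [reg]
    rw [hsum, e2]
    by_cases hjR : j ∈ R
    · rw [if_pos hjR] at hgj
      have e3 : x j * (∇ f x) j = -(ρ * x j ^ 2) := by
        rw [show (∇ f x) j = -(ρ * x j) by linarith]; ring
      split_ifs <;> nlinarith
    · rw [if_neg hjR] at hgj
      have e3 : x j * (∇ f x) j = 0 := by
        rw [show (∇ f x) j = 0 by linarith]; ring
      split_ifs <;> nlinarith

/-- The arithmetic behind `sum_sq_lt_of_no_progress`: eliminating the squared gradient `G`. The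
summand `9 / 4 * P` bounds `s * x_j ^ 2` for the removed coordinate `j`. -/
theorem lt_of_swap_gain {ρ ρ' κ G P Q : ℝ} (hρ' : 0 < ρ') (hκ : 1 ≤ κ) (hρ : ρ = κ * ρ')
    (hP : 0 ≤ P)
    (hgain : (12 * κ + 6) * G / (4 * ρ) - ρ * (9 / 4 * P) <
      1 / (2 * ρ') * G - ρ * P + ρ ^ 2 / (2 * ρ') * Q + ρ / 2 * (Q + P))
    (hG : 2 * κ * ρ' ^ 2 * P - κ ^ 2 * ρ' ^ 2 * Q < G) : P < (3 * κ + 2) * Q := by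
  subst hρ
  have h1 : (12 * κ + 6) * G / (4 * (κ * ρ')) - 1 / (2 * ρ') * G =
      (10 * κ + 6) / (4 * (κ * ρ')) * G := by
    field_simp
    ring
  have h2 : (10 * κ + 6) / (4 * (κ * ρ')) * (2 * κ * ρ' ^ 2 * P - κ ^ 2 * ρ' ^ 2 * Q) ≤
      (10 * κ + 6) / (4 * (κ * ρ')) * G := by gcongr
  have h3 : (10 * κ + 6) / (4 * (κ * ρ')) * (2 * κ * ρ' ^ 2 * P - κ ^ 2 * ρ' ^ 2 * Q) =
      ρ' * ((10 * κ + 6) * (2 * P - κ * Q) / 4) := by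
    field_simp
  have h4 : (κ * ρ') ^ 2 / (2 * ρ') * Q = ρ' * (κ ^ 2 / 2 * Q) := by
    field_simp
  have h5 : ρ' * ((10 * κ + 6) * (2 * P - κ * Q) / 4) <
      ρ' * (κ * (9 / 4 * P) - κ * P + κ ^ 2 / 2 * Q + κ / 2 * (Q + P)) := by linarith
  have h6 := lt_of_mul_lt_mul_left h5 hρ'.le
  have h7 : 0 ≤ κ * P := by positivity
  have h8 : κ * P < κ * ((3 * κ + 2) * Q) := by linarith
  exact lt_of_mul_lt_mul_left h8 (by linarith)

/-- If an iteration of the core routine on a set `S` none of whose vectors reaches the target makes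
too little progress, then a nonnegligible part of the regularized mass of `x` lies in the support
of any sparse vector `z` that reaches the target. -/
theorem sum_sq_lt_of_no_progress {n s sstar : ℕ} {f : E n → ℝ} {ρ ρ' : ℝ}
    (hf : Differentiable ℝ f) (hsm : RestrictedSmooth f 2 ρ)
    (hconv : RestrictedStronglyConvex f (s + sstar) ρ') (hρ' : 0 < ρ') (hρ : ρ' ≤ ρ)
    (hstar : 1 ≤ sstar) (hs : (sstar : ℝ) * (12 * (ρ / ρ') + 6) ≤ s)
    {S R : Finset (Fin n)} (hS : S.card = s) {x z : E n} {opt : ℝ}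
    (hx : IsRestrictedMinimizer (reg f ρ R) S x) {i j : Fin n}
    (hi : ∀ k, |(∇ (reg f ρ R) x) k| ≤ |(∇ (reg f ρ R) x) i|) (hj : j ∈ S)
    (hjmin : ∀ k ∈ S, |x j| ≤ |x k|) (hR : 2 * Rᶜ.card < s)
    (hz : IsSparse sstar z) (hzopt : f z ≤ opt) (hopt : opt < f x)
    (hprog : ∀ y, supp y ⊆ (insert i S).erase j →
      reg f ρ R x - reg f ρ R y < 1 / (s : ℝ) * (reg f ρ R x - opt)) :
    ∑ k ∈ R, x k ^ 2 < (3 * (ρ / ρ') + 3) * ∑ k ∈ R ∩ supp z, x k ^ 2 := by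
  have hρ0 : 0 < ρ := hρ'.trans_le hρ
  have hκ : 1 ≤ ρ / ρ' := (one_le_div hρ').mpr hρ
  have hstarR : (1 : ℝ) ≤ sstar := by exact_mod_cast hstar
  have hs18 : 18 * (sstar : ℝ) ≤ s := by nlinarith
  have hsp : IsSparse (s + sstar) (z - x) := by
    refine isSparse_of_supp_subset (supp_sub_subset le_rfl hx.1) ?_
    have := Finset.card_union_le (supp z) S
    have := hz
    unfold IsSparse at this
    omega
  have hA := sub_le_of_restrictedStronglyConvex hf hconv hρ' hx hsp
  have hsplit : ∑ k ∈ R, x k ^ 2 = ∑ k ∈ R ∩ supp z, x k ^ 2 + ∑ k ∈ R \ supp z, x k ^ 2 :=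
    (Finset.sum_inter_add_sum_sdiff R (supp z) _).symm
  have hP0 : 0 ≤ ∑ k ∈ R \ supp z, x k ^ 2 := by positivity
  have hQ0 : 0 ≤ ∑ k ∈ R ∩ supp z, x k ^ 2 := by positivity
  have hreg : reg f ρ R x = f x + ρ / 2 * ∑ k ∈ R, x k ^ 2 := rfl
  have hG1 : ∑ k ∈ supp z \ S, (∇ (reg f ρ R) x) k ^ 2 ≤
      sstar * (∇ (reg f ρ R) x) i ^ 2 := by
    calc _ ≤ ∑ k ∈ supp z \ S, (∇ (reg f ρ R) x) i ^ 2 :=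
          Finset.sum_le_sum fun k _ => sq_le_sq.mpr (hi k)
      _ = ((supp z \ S).card : ℝ) * (∇ (reg f ρ R) x) i ^ 2 := by
          rw [Finset.sum_const, nsmul_eq_mul]
      _ ≤ _ := by
          gcongr
          exact (Finset.card_le_card Finset.sdiff_subset).trans hz
  -- the number of regularized coordinates that can be exchanged is at least `4 s / 9`
  have hxj : 4 * (s : ℝ) * x j ^ 2 ≤ 9 * ∑ k ∈ R \ supp z, x k ^ 2 := by
    have h1 : (4 * s : ℝ) ≤ 9 * ((S ∩ R) \ supp z).card := by
      have c1 : s ≤ ((S ∩ R) \ supp z).card + Rᶜ.card + (supp z).card := by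
        have hsub : S ⊆ (((S ∩ R) \ supp z) ∪ Rᶜ) ∪ supp z := by
          intro k hk
          simp only [Finset.mem_union, Finset.mem_sdiff, Finset.mem_inter, Finset.mem_compl]
          tauto
        have := Finset.card_le_card hsub
        have := Finset.card_union_le (((S ∩ R) \ supp z) ∪ Rᶜ) (supp z)
        have := Finset.card_union_le ((S ∩ R) \ supp z) Rᶜ
        omega
      have c2 : (supp z).card ≤ sstar := hz
      have c3 : 18 * sstar ≤ s := by exact_mod_cast hs18
      have c4 : 4 * s ≤ 9 * ((S ∩ R) \ supp z).card := by omega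
      exact_mod_cast c4
    have h2 : (((S ∩ R) \ supp z).card : ℝ) * x j ^ 2 ≤ ∑ k ∈ R \ supp z, x k ^ 2 := by
      calc _ = ∑ k ∈ (S ∩ R) \ supp z, x j ^ 2 := by rw [Finset.sum_const, nsmul_eq_mul]
        _ ≤ ∑ k ∈ (S ∩ R) \ supp z, x k ^ 2 := Finset.sum_le_sum fun k hk =>
            sq_le_sq.mpr (hjmin k (Finset.mem_inter.mp (Finset.mem_sdiff.mp hk).1).1)
        _ ≤ _ := Finset.sum_le_sum_of_subset_of_nonneg
            (Finset.sdiff_subset_sdiff Finset.inter_subset_right le_rfl)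
            fun k _ _ => sq_nonneg _
    nlinarith [sq_nonneg (x j)]
  rw [hsplit] at hreg ⊢
  have hGS : i ∈ S → ∑ k ∈ supp z \ S, (∇ (reg f ρ R) x) k ^ 2 = 0 := by
    intro hiS
    rw [hx.gradient_eq_zero (differentiable_reg hf ρ R x) hiS] at hG1
    have : 0 ≤ ∑ k ∈ supp z \ S, (∇ (reg f ρ R) x) k ^ 2 := by positivity
    nlinarith
  set G := ∑ k ∈ supp z \ S, (∇ (reg f ρ R) x) k ^ 2
  set P := ∑ k ∈ R \ supp z, x k ^ 2
  set Q := ∑ k ∈ R ∩ supp z, x k ^ 2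
  have hρκ : ρ = ρ / ρ' * ρ' := by field_simp
  set κ := ρ / ρ'
  clear_value G P Q κ
  -- `G` is bounded below in terms of `P` and `Q`, because `f z < f x`
  have hB : 2 * κ * ρ' ^ 2 * P - κ ^ 2 * ρ' ^ 2 * Q < G := by
    have h1 : 0 < 1 / (2 * ρ') * G - ρ * P + ρ ^ 2 / (2 * ρ') * Q := by linarith
    have h2 := mul_pos (by positivity : 0 < 2 * ρ') h1
    have h3 : 2 * ρ' * (1 / (2 * ρ') * G - ρ * P + ρ ^ 2 / (2 * ρ') * Q) =
        G - 2 * ρ' * ρ * P + ρ ^ 2 * Q := by field_simp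
    rw [h3, hρκ] at h2
    nlinarith
  have hρ2 : 0 < ρ' ^ 2 := by positivity
  by_cases hiS : i ∈ S
  -- the gradient vanishes on `S`, so here it vanishes altogether
  · rw [hGS hiS] at hB
    have h1 : 0 < κ * ρ' ^ 2 * (κ * Q - 2 * P) := by linarith
    have h2 : 0 < κ * Q - 2 * P := pos_of_mul_pos_right h1 (by positivity)
    nlinarith
  · obtain ⟨y, hyS, hy⟩ := exists_reg_le_of_swap hf hsm hρ0 hx hiS hj
    have h1 := hprog y hyS
    have hs0 : (0 : ℝ) < s := by linarith
    -- no progress, multiplied by `s`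
    have h2 : s * ((∇ (reg f ρ R) x) i ^ 2 / (4 * ρ) - ρ * x j ^ 2) < reg f ρ R x - opt := by
      have : s * (reg f ρ R x - reg f ρ R y) < reg f ρ R x - opt := by
        rw [one_div, inv_mul_eq_div, lt_div_iff₀ hs0] at h1
        linarith
      nlinarith
    have h3 : (12 * κ + 6) * G / (4 * ρ) ≤ s * ((∇ (reg f ρ R) x) i ^ 2 / (4 * ρ)) := by
      rw [← mul_div_assoc]
      refine div_le_div_of_nonneg_right ?_ (by positivity)
      nlinarith [sq_nonneg ((∇ (reg f ρ R) x) i)]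
    have h4 : (12 * κ + 6) * G / (4 * ρ) - ρ * (9 / 4 * P) < 1 / (2 * ρ') * G - ρ * P +
        ρ ^ 2 / (2 * ρ') * Q + ρ / 2 * (Q + P) := by
      have e1 : ρ * (s * x j ^ 2) ≤ ρ * (9 / 4 * P) :=
        mul_le_mul_of_nonneg_left (by linarith) hρ0.le
      have e2 : s * ((∇ (reg f ρ R) x) i ^ 2 / (4 * ρ) - ρ * x j ^ 2) =
          s * ((∇ (reg f ρ R) x) i ^ 2 / (4 * ρ)) - ρ * (s * x j ^ 2) := by ring
      linarith
    have h5 := lt_of_swap_gain hρ' hκ hρκ hP0 h4 hB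
    linarith

/-! ### Probability mass functions -/

theorem toOuterMeasure_le_one {α : Type*} (μ : PMF α) (A : Set α) : μ.toOuterMeasure A ≤ 1 := by
  rw [← (μ.toOuterMeasure_apply_eq_one_iff Set.univ).mpr (Set.subset_univ _)]
  exact μ.toOuterMeasure.mono (Set.subset_univ A)

theorem toOuterMeasure_eq_zero {α : Type*} {μ : PMF α} {A : Set α}
    (h : ∀ a ∈ μ.support, a ∉ A) : μ.toOuterMeasure A = 0 :=
  (μ.toOuterMeasure_apply_eq_zero_iff A).mpr (Set.disjoint_left.mpr h)

/-- A union bound: if the second stage fails with probability at most `c + d` after a bad outcome of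
the first stage and at most `d` after any other outcome, then both together fail with probability at
most `c` times that of a bad outcome, plus `d`. -/
theorem toOuterMeasure_bind_le {α β : Type*} {μ : PMF α} {F : α → PMF β} {A : Set β}
    {bad : Set α} {c d : ENNReal}
    (h : ∀ a ∈ μ.support, (F a).toOuterMeasure A ≤ bad.indicator (fun _ => c) a + d) :
    (μ.bind F).toOuterMeasure A ≤ c * μ.toOuterMeasure bad + d := by
  rw [PMF.toOuterMeasure_bind_apply]
  calc ∑' a, μ a * (F a).toOuterMeasure A
      ≤ ∑' a, (c * bad.indicator μ a + μ a * d) := by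
        refine ENNReal.tsum_le_tsum fun a => ?_
        by_cases ha : μ a = 0
        · simp [ha]
        · calc μ a * (F a).toOuterMeasure A ≤ μ a * (bad.indicator (fun _ => c) a + d) := by
                gcongr
                exact h a ha
            _ = _ := by
                rw [mul_add]
                by_cases hb : a ∈ bad <;> simp [hb, mul_comm]
    _ = _ := by
        rw [ENNReal.tsum_add, ENNReal.tsum_mul_left, ENNReal.tsum_mul_right, μ.tsum_coe, one_mul,
          PMF.toOuterMeasure_apply]

/-! ### The core routine -/

theorem mem_insertCandidates {n : ℕ} {h : E n → ℝ} {x : E n} {i : Fin n} :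
    i ∈ insertCandidates h x ↔ ∀ k, |(∇ h x) k| ≤ |(∇ h x) i| := by
  simp [insertCandidates]

theorem mem_removeCandidates {n : ℕ} {S : Finset (Fin n)} {x : E n} {j : Fin n} :
    j ∈ removeCandidates S x ↔ j ∈ S ∧ ∀ k ∈ S, |x j| ≤ |x k| := by
  simp [removeCandidates]

/-- The standing assumptions on the objective and on the sparsity levels. -/
structure Setting {n : ℕ} (f : E n → ℝ) (s sstar : ℕ) (ρ ρ' : ℝ) : Prop where
  differentiable : Differentiable ℝ f
  smooth : RestrictedSmooth f 2 ρ
  convex : RestrictedStronglyConvex f (s + sstar) ρ'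
  pos : 0 < ρ'
  le : ρ' ≤ ρ
  one_le_sstar : 1 ≤ sstar
  sparsity : (sstar : ℝ) * (12 * (ρ / ρ') + 6) ≤ s
  le_dim : s ≤ n

namespace Setting

variable {n s sstar : ℕ} {f : E n → ℝ} {ρ ρ' : ℝ}

theorem smooth_pos (H : Setting f s sstar ρ ρ') : 0 < ρ := H.pos.trans_le H.le

theorem one_le_cond (H : Setting f s sstar ρ ρ') : 1 ≤ ρ / ρ' := (one_le_div H.pos).mpr H.le

theorem le_s (H : Setting f s sstar ρ ρ') : 18 ≤ s := by
  have h1 : (1 : ℝ) ≤ sstar := by exact_mod_cast H.one_le_sstar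
  have h2 := H.one_le_cond
  have h3 := H.sparsity
  have : (18 : ℝ) ≤ s := by nlinarith
  exact_mod_cast this

theorem argminOn_reg (H : Setting f s sstar ρ ρ') {S : Finset (Fin n)} (hS : S.card ≤ s)
    (R : Finset (Fin n)) : IsRestrictedMinimizer (reg f ρ R) S (argminOn (reg f ρ R) S) :=
  isRestrictedMinimizer_argminOn (H.convex.exists_isRestrictedMinimizer_reg H.differentiable H.pos
    H.smooth_pos.le (hS.trans (Nat.le_add_right _ _)) R)

theorem argminOn (H : Setting f s sstar ρ ρ') {S : Finset (Fin n)} (hS : S.card ≤ s) :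
    IsRestrictedMinimizer f S (argminOn f S) := by
  simpa only [reg_empty] using H.argminOn_reg hS ∅

end Setting

/-- The invariant of the core routine: the support set has exactly `s` elements, and the current
solution minimizes the regularized objective on it. -/
def State.IsValid {n : ℕ} (σ : State n) (f : E n → ℝ) (ρ : ℝ) (s : ℕ) : Prop :=
  σ.S.card = s ∧ IsRestrictedMinimizer (reg f ρ σ.R) σ.S σ.x

/-- The state after coordinate `k` ceases to be regularized. -/
def State.unregularize {n : ℕ} (σ : State n) (f : E n → ℝ) (ρ : ℝ) (k : Fin n) : State n :=
  ⟨σ.S, σ.R.erase k, argminOn (reg f ρ (σ.R.erase k)) σ.S⟩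

section

variable {n s sstar : ℕ} {f : E n → ℝ} {ρ ρ' : ℝ} {K : Conventions n} {σ : State n} {opt : ℝ}

theorem State.IsValid.unregularize (H : Setting f s sstar ρ ρ') (hσ : σ.IsValid f ρ s)
    (k : Fin n) : (σ.unregularize f ρ k).IsValid f ρ s :=
  ⟨hσ.1, H.argminOn_reg hσ.1.le _⟩

theorem State.IsValid.reg_unregularize_le (H : Setting f s sstar ρ ρ') (hσ : σ.IsValid f ρ s)
    (k : Fin n) : reg f ρ (σ.unregularize f ρ k).R (σ.unregularize f ρ k).x ≤
      reg f ρ σ.R σ.x :=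
  ((hσ.unregularize H k).2.2 σ.x hσ.2.1).trans
    (reg_mono f H.smooth_pos.le (Finset.erase_subset k σ.R) σ.x)

theorem isValid_coreInit (H : Setting f s sstar ρ ρ') : (coreInit f ρ s).IsValid f ρ s := by
  have hc : (Finset.univ.filter fun i : Fin n => i.val < s).card = s := by
    rw [Fin.card_filter_val_lt, min_eq_right H.le_dim]
  exact ⟨hc, H.argminOn_reg hc.le _⟩

/-- An iteration of the core routine that does not return makes progress and keeps the regularized
set, or it samples a coordinate, in which case the support of every sufficiently good sparse
vector carries a nonnegligible part of the regularized mass. -/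
theorem coreStep_cases (H : Setting f s sstar ρ ρ') (hσ : σ.IsValid f ρ s)
    (hopt : ¬ f (argminOn f σ.S) ≤ opt) :
    (∃ σ' : State n, coreStep K f ρ s opt σ = PMF.pure σ' ∧ σ'.IsValid f ρ s ∧ σ'.R = σ.R ∧
      reg f ρ σ'.R σ'.x - opt ≤ (1 - 1 / (s : ℝ)) * (reg f ρ σ.R σ.x - opt)) ∨
    (coreStep K f ρ s opt σ = (sampleLaw K σ).map (σ.unregularize f ρ) ∧
      ∀ z, IsSparse sstar z → f z ≤ opt → 2 * σ.Rᶜ.card < s →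
        ∑ k ∈ σ.R, σ.x k ^ 2 < (3 * (ρ / ρ') + 3) * ∑ k ∈ σ.R ∩ supp z, σ.x k ^ 2) := by
  have hs := H.le_s
  have hs0 : (0 : ℝ) < s := by exact_mod_cast (by omega : 0 < s)
  have hfx : opt < f σ.x := (not_le.mp hopt).trans_le ((H.argminOn hσ.1.le).2 σ.x hσ.2.1)
  have hgx : opt < reg f ρ σ.R σ.x := hfx.trans_le (le_reg f H.smooth_pos.le _ _)
  set i := K.pickInsert σ (insertCandidates (reg f ρ σ.R) σ.x)
  set j := K.pickRemove σ (removeCandidates σ.S σ.x)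
  have hi : ∀ k, |(∇ (reg f ρ σ.R) σ.x) k| ≤ |(∇ (reg f ρ σ.R) σ.x) i| := by
    have : Nonempty (Fin n) := ⟨⟨0, by have := H.le_dim; omega⟩⟩
    obtain ⟨i₀, hi₀⟩ := Finite.exists_max fun k => |(∇ (reg f ρ σ.R) σ.x) k|
    exact mem_insertCandidates.mp (K.pickInsert_mem σ (insertCandidates (reg f ρ σ.R) σ.x)
      ⟨i₀, mem_insertCandidates.mpr hi₀⟩)
  have hj : j ∈ σ.S ∧ ∀ k ∈ σ.S, |σ.x j| ≤ |σ.x k| := by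
    obtain ⟨j₀, hj₀, hmin⟩ := σ.S.exists_min_image (fun k => |σ.x k|)
      (Finset.card_pos.mp (by rw [hσ.1]; omega))
    exact mem_removeCandidates.mp (K.pickRemove_mem σ (removeCandidates σ.S σ.x)
      ⟨j₀, mem_removeCandidates.mpr ⟨hj₀, hmin⟩⟩)
  have hcard : ((insert i σ.S).erase j).card ≤ s := by
    rw [Finset.card_erase_of_mem (Finset.mem_insert_of_mem hj.1)]
    have := Finset.card_insert_le i σ.S
    rw [hσ.1] at this
    omega
  have hx' := H.argminOn_reg hcard σ.R
  by_cases hprog : reg f ρ σ.R σ.x -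
      reg f ρ σ.R (argminOn (reg f ρ σ.R) ((insert i σ.S).erase j)) <
      1 / (s : ℝ) * (reg f ρ σ.R σ.x - opt)
  · refine Or.inr ⟨?_, fun z hz hzopt hR => ?_⟩
    · simp only [coreStep]
      rw [if_pos hprog]
      rfl
    · refine sum_sq_lt_of_no_progress H.differentiable H.smooth H.convex H.pos H.le H.one_le_sstar
        H.sparsity hσ.1 hσ.2 hi hj.1 hj.2 hR hz hzopt hfx fun y hy => ?_
      linarith [hx'.2 y hy]
  · refine Or.inl ⟨⟨(insert i σ.S).erase j, σ.R,
      argminOn (reg f ρ σ.R) ((insert i σ.S).erase j)⟩, ?_, ⟨?_, hx'⟩, rfl, ?_⟩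
    · simp only [coreStep]
      rw [if_neg hprog]
    -- if `i` were in `S`, then the new support set would be smaller and could not yield progress
    · have hiS : i ∉ σ.S := by
        intro hiS
        rw [Finset.insert_eq_of_mem hiS] at hprog hx'
        have h1 := hσ.2.2 _ (hx'.1.trans (Finset.erase_subset _ _))
        have h2 : 0 < 1 / (s : ℝ) * (reg f ρ σ.R σ.x - opt) :=
          mul_pos (by positivity) (sub_pos.mpr hgx)
        linarith
      rw [Finset.card_erase_of_mem (Finset.mem_insert_of_mem hj.1),
        Finset.card_insert_of_notMem hiS, hσ.1]
      rfl
    · simp only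
      linarith

theorem coreLoop_support (H : Setting f s sstar ρ ρ') (T : ℕ) (hσ : σ.IsValid f ρ s)
    {p : E n × ℕ} (hp : p ∈ (coreLoop K f ρ s opt T σ).support) :
    IsSparse s p.1 ∧ p.2 ≤ T := by
  induction T generalizing σ p with
  | zero =>
    rw [coreLoop, PMF.mem_support_pure_iff] at hp
    subst hp
    exact ⟨isSparse_of_supp_subset hσ.2.1 hσ.1.le, le_rfl⟩
  | succ T ih =>
    rw [coreLoop] at hp
    split_ifs at hp with hopt
    · rw [PMF.mem_support_pure_iff] at hp
      subst hp
      exact ⟨isSparse_of_supp_subset (H.argminOn hσ.1.le).1 hσ.1.le, by simp⟩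
    · rw [PMF.mem_support_bind_iff] at hp
      obtain ⟨σ', hσ', hp⟩ := hp
      rw [PMF.mem_support_map_iff] at hp
      obtain ⟨q, hq, rfl⟩ := hp
      have hvalid : σ'.IsValid f ρ s := by
        rcases coreStep_cases (K := K) H hσ hopt with ⟨τ, hτ, hv, -⟩ | ⟨hτ, -⟩
        · rw [hτ, PMF.mem_support_pure_iff] at hσ'
          rwa [hσ']
        · rw [hτ, PMF.mem_support_map_iff] at hσ'
          obtain ⟨k, -, rfl⟩ := hσ'
          exact hσ.unregularize H k
      have := ih hvalid hq
      exact ⟨this.1, by simpa using this.2⟩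

theorem sampleLaw_apply (hpos : 0 < ∑ k ∈ σ.R, σ.x k ^ 2) (k : Fin n) :
    sampleLaw K σ k =
      ENNReal.ofReal ((if k ∈ σ.R then σ.x k ^ 2 else 0) / ∑ k ∈ σ.R, σ.x k ^ 2) := by
  have hex : ∃ i ∈ σ.R, σ.x i ≠ 0 := by
    obtain ⟨i, hi, hne⟩ := Finset.exists_ne_zero_of_sum_ne_zero hpos.ne'
    exact ⟨i, hi, by simpa using hne⟩
  have hw : ∀ k, sampleWeight σ.R σ.x k =
      ENNReal.ofReal (if k ∈ σ.R then σ.x k ^ 2 else 0) := by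
    intro k
    unfold sampleWeight
    split_ifs <;> simp
  have hsum : ∑' k, sampleWeight σ.R σ.x k = ENNReal.ofReal (∑ k ∈ σ.R, σ.x k ^ 2) := by
    rw [tsum_fintype, Finset.sum_congr rfl fun k _ => hw k, ← ENNReal.ofReal_sum_of_nonneg,
      Finset.sum_ite_mem, Finset.univ_inter]
    intro k _
    positivity
  rw [sampleLaw, dif_pos hex, PMF.normalize_apply, hsum, hw, ENNReal.ofReal_div_of_pos hpos,
    div_eq_mul_inv]

/-- Upper bound for the failure probability of the core routine in a state whose set of regularized
coordinates is `R`: twice the potential `(3 ρ / ρ' + 3) |R ∩ supp z| + |Rᶜ|`, divided by `s`. -/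
def failureBound (n s : ℕ) (κ : ℝ) (Z R : Finset (Fin n)) : ℝ :=
  2 * ((3 * κ + 3) * (R ∩ Z).card + Rᶜ.card) / s

/-- The failure bound is a supermartingale along the sampling steps. -/
theorem sum_failureBound_erase_le {κ : ℝ} {Z R : Finset (Fin n)} {w : Fin n → ℝ}
    (hpos : 0 < ∑ k ∈ R, w k) (hw : ∑ k ∈ R, w k ≤ (3 * κ + 3) * ∑ k ∈ R ∩ Z, w k) :
    ∑ k, (if k ∈ R then w k else 0) / (∑ k ∈ R, w k) * failureBound n s κ Z (R.erase k) ≤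
      failureBound n s κ Z R := by
  have h1 : ∀ k ∈ R, failureBound n s κ Z (R.erase k) =
      failureBound n s κ Z R + 2 / s - (if k ∈ Z then 2 * (3 * κ + 3) / s else 0) := by
    intro k hk
    have c1 : ((R.erase k)ᶜ.card : ℝ) = Rᶜ.card + 1 := by
      rw [Finset.compl_erase, Finset.card_insert_of_notMem (by simpa using hk)]
      push_cast
      rfl
    have c2 : ((R.erase k ∩ Z).card : ℝ) = (R ∩ Z).card - if k ∈ Z then 1 else 0 := by
      rw [Finset.erase_inter]
      split_ifs with hkZ
      · rw [Finset.cast_card_erase_of_mem (Finset.mem_inter.mpr ⟨hk, hkZ⟩)]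
      · rw [Finset.erase_eq_of_notMem fun h => hkZ (Finset.mem_inter.mp h).2, sub_zero]
    rw [failureBound, failureBound, c1, c2]
    split_ifs <;> ring
  have h2 : ∀ k, (if k ∈ R then w k else 0) / (∑ k ∈ R, w k) * failureBound n s κ Z (R.erase k) =
      if k ∈ R then (w k * (failureBound n s κ Z R + 2 / s) -
        (if k ∈ Z then w k * (2 * (3 * κ + 3) / s) else 0)) / (∑ k ∈ R, w k) else 0 := by
    intro k
    split_ifs with hk hkZ
    · rw [h1 k hk, if_pos hkZ]
      ring
    · rw [h1 k hk, if_neg hkZ]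
      ring
    · simp
  rw [Finset.sum_congr rfl fun k _ => h2 k, Finset.sum_ite_mem, Finset.univ_inter,
    ← Finset.sum_div, Finset.sum_sub_distrib, ← Finset.sum_mul, Finset.sum_ite_mem,
    ← Finset.sum_mul, div_le_iff₀ hpos]
  have h3 : (∑ k ∈ R, w k) * (2 / s) ≤ (3 * κ + 3) * (∑ k ∈ R ∩ Z, w k) * (2 / s) := by gcongr
  have h4 : (∑ k ∈ R ∩ Z, w k) * (2 * (3 * κ + 3) / s) =
      (3 * κ + 3) * (∑ k ∈ R ∩ Z, w k) * (2 / s) := by ring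
  linarith

/-- Failure probability of the core loop with `T` iterations left: at most `s - |Rᶜ|` of them are
charged to sampling, each of the others contracts the optimality gap by the factor `1 - 1 / s`. -/
theorem coreLoop_failure (H : Setting f s sstar ρ ρ') {z : E n} (hz : IsSparse sstar z)
    (hzopt : f z ≤ opt) {δ : ℝ} (hδ : 0 ≤ δ) (T : ℕ) (hσ : σ.IsValid f ρ s)
    (hgap : (reg f ρ σ.R σ.x - opt) * (1 - 1 / (s : ℝ)) ^ (T - (s - σ.Rᶜ.card)) ≤ δ) :
    (coreLoop K f ρ s opt T σ).toOuterMeasure {p | ¬ f p.1 ≤ opt + δ} ≤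
      ENNReal.ofReal (failureBound n s (ρ / ρ') (supp z) σ.R) := by
  have hs : (18 : ℝ) ≤ s := by exact_mod_cast H.le_s
  have hκ := H.one_le_cond
  have hq0 : 0 ≤ 1 - 1 / (s : ℝ) := by
    rw [sub_nonneg, div_le_one (by linarith)]
    linarith
  have hq1 : 1 - 1 / (s : ℝ) ≤ 1 := by
    have : 0 ≤ 1 / (s : ℝ) := by positivity
    linarith
  induction T generalizing σ with
  | zero =>
    refine (toOuterMeasure_eq_zero fun p hp => ?_).trans_le zero_le
    rw [coreLoop, PMF.mem_support_pure_iff] at hp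
    subst hp
    rw [Nat.zero_sub, pow_zero, mul_one] at hgap
    have := le_reg f H.smooth_pos.le σ.R σ.x
    simp only [Set.mem_ofPred_eq, not_not]
    linarith
  | succ T ih =>
    rw [coreLoop]
    split_ifs with hopt
    · refine (toOuterMeasure_eq_zero fun p hp => ?_).trans_le zero_le
      rw [PMF.mem_support_pure_iff] at hp
      subst hp
      simp only [Set.mem_ofPred_eq, not_not]
      linarith
    -- once half of the budget is used up, the bound is trivial
    by_cases hR : 2 * σ.Rᶜ.card < s
    swap
    · refine (toOuterMeasure_le_one _ _).trans ?_
      rw [ENNReal.one_le_ofReal, failureBound, le_div_iff₀ (by linarith)]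
      have h1 : (s : ℝ) ≤ 2 * σ.Rᶜ.card := by exact_mod_cast not_lt.mp hR
      have h2 : 0 ≤ (3 * (ρ / ρ') + 3) * ((σ.R ∩ supp z).card : ℝ) := by positivity
      linarith
    have hgx : opt < reg f ρ σ.R σ.x := (not_le.mp hopt).trans_le
      (((H.argminOn hσ.1.le).2 σ.x hσ.2.1).trans (le_reg f H.smooth_pos.le _ _))
    have hmap : ∀ τ : State n,
        ((coreLoop K f ρ s opt T τ).map fun p => (p.1, p.2 + 1)).toOuterMeasure
          {p | ¬ f p.1 ≤ opt + δ} =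
        (coreLoop K f ρ s opt T τ).toOuterMeasure {p | ¬ f p.1 ≤ opt + δ} := by
      intro τ
      rw [PMF.toOuterMeasure_map_apply]
      rfl
    rcases coreStep_cases (K := K) H hσ hopt with ⟨τ, hτ, hv, hτR, hτgap⟩ | ⟨hτ, hmass⟩
    · rw [hτ, PMF.pure_bind, hmap, ← hτR]
      refine ih hv ?_
      rw [hτR] at hτgap ⊢
      refine le_trans ?_ hgap
      refine (mul_le_mul_of_nonneg_right hτgap (pow_nonneg hq0 _)).trans ?_
      rw [mul_comm (1 - 1 / (s : ℝ)), mul_assoc, ← pow_succ']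
      refine mul_le_mul_of_nonneg_left (pow_le_pow_of_le_one hq0 hq1 ?_) (by linarith)
      omega
    · have hlt := hmass z hz hzopt hR
      have hW : 0 < ∑ k ∈ σ.R, σ.x k ^ 2 := by
        have h0 : 0 ≤ ∑ k ∈ σ.R, σ.x k ^ 2 := by positivity
        have h1 : 0 < ∑ k ∈ σ.R ∩ supp z, σ.x k ^ 2 :=
          pos_of_mul_pos_right (h0.trans_lt hlt) (by linarith)
        exact h1.trans_le (Finset.sum_le_sum_of_subset_of_nonneg Finset.inter_subset_left
          fun k _ _ => sq_nonneg _)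
      rw [hτ, PMF.bind_map, PMF.toOuterMeasure_bind_apply, tsum_fintype]
      refine le_trans ?_ (ENNReal.ofReal_le_ofReal (sum_failureBound_erase_le (s := s) hW hlt.le))
      have hnn : ∀ R, 0 ≤ failureBound n s (ρ / ρ') (supp z) R := by
        intro R
        unfold failureBound
        positivity
      rw [ENNReal.ofReal_sum_of_nonneg fun k _ => mul_nonneg (by positivity) (hnn _)]
      refine Finset.sum_le_sum fun k _ => ?_
      rw [sampleLaw_apply hW, ENNReal.ofReal_mul (by positivity)]
      by_cases hk : k ∈ σ.R
      · gcongr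
        rw [Function.comp_apply, hmap]
        refine ih (hσ.unregularize H k) (le_trans ?_ hgap)
        have hcard : (σ.unregularize f ρ k).Rᶜ.card = σ.Rᶜ.card + 1 := by
          rw [State.unregularize, Finset.compl_erase,
            Finset.card_insert_of_notMem (by simpa using hk)]
        have hexp : T - (s - (σ.unregularize f ρ k).Rᶜ.card) = T + 1 - (s - σ.Rᶜ.card) := by
          omega
        rw [hexp]
        exact mul_le_mul_of_nonneg_right (sub_le_sub_right (hσ.reg_unregularize_le H k) _)
          (pow_nonneg hq0 _)
      · simp [hk]

/-- The outputs of the core routine are sparse, and its iterations are bounded. -/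
theorem core_support (H : Setting f s sstar ρ ρ') {δ : ℝ} {p : E n × ℕ}
    (hp : p ∈ (core K f ρ s opt δ).support) :
    IsSparse s p.1 ∧ p.2 ≤ ⌈2 * (s : ℝ) * Real.log ((f 0 - minValue f) / δ)⌉₊ :=
  coreLoop_support H _ (isValid_coreInit H) hp

/-- A single run of the core routine fails with probability at most `2 / 3`. -/
theorem core_failure (H : Setting f s sstar ρ ρ') {z : E n} (hz : IsSparse sstar z)
    (hzopt : f z ≤ opt) (hB : minValue f ≤ opt) {δ : ℝ} (hδ : 0 < δ)
    (hD : 0 < f 0 - minValue f) (hlog : 1 ≤ Real.log ((f 0 - minValue f) / δ)) :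
    (core K f ρ s opt δ).toOuterMeasure {p | ¬ f p.1 ≤ opt + δ} ≤ ENNReal.ofReal (2 / 3) := by
  have hs : (18 : ℝ) ≤ s := by exact_mod_cast H.le_s
  have hκ := H.one_le_cond
  have hv := isValid_coreInit H
  have hR : (coreInit f ρ s).R = Finset.univ := rfl
  set ℓ := Real.log ((f 0 - minValue f) / δ) with hℓ
  set T := ⌈2 * (s : ℝ) * ℓ⌉₊ with hT
  have hTle : 2 * (s : ℝ) * ℓ ≤ T := Nat.le_ceil _
  refine (coreLoop_failure H hz hzopt hδ.le T hv ?_).trans (ENNReal.ofReal_le_ofReal ?_)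
  · rw [hR, Finset.compl_univ, Finset.card_empty, Nat.sub_zero]
    have h0 : reg f ρ Finset.univ (coreInit f ρ s).x - opt ≤ f 0 - minValue f := by
      have h1 := hv.2.2 0 (supp_zero_subset _)
      have h2 : reg f ρ (coreInit f ρ s).R 0 = f 0 := by simp [reg]
      rw [h2, hR] at h1
      linarith
    have hsub : (s : ℝ) * ℓ ≤ (T - s : ℕ) := by
      have h1 : (T : ℝ) - s ≤ (T - s : ℕ) := by
        have : T ≤ (T - s) + s := by omega
        have : (T : ℝ) ≤ (T - s : ℕ) + s := by exact_mod_cast this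
        linarith
      nlinarith
    have hq0 : 0 ≤ 1 - 1 / (s : ℝ) := by
      rw [sub_nonneg, div_le_one (by linarith)]
      linarith
    have hpow : (1 - 1 / (s : ℝ)) ^ (T - s) ≤ δ / (f 0 - minValue f) := by
      calc (1 - 1 / (s : ℝ)) ^ (T - s) ≤ Real.exp (-(1 / (s : ℝ))) ^ (T - s) :=
            pow_le_pow_left₀ hq0 (Real.one_sub_le_exp_neg _) _
        _ = Real.exp (-((T - s : ℕ) / (s : ℝ))) := by
            rw [← Real.exp_nat_mul]
            congr 1
            ring
        _ ≤ Real.exp (-ℓ) := by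
            rw [Real.exp_le_exp, neg_le_neg_iff, le_div_iff₀ (by linarith)]
            linarith
        _ = δ / (f 0 - minValue f) := by
            rw [Real.exp_neg, hℓ, Real.exp_log (by positivity), inv_div]
    calc _ ≤ (f 0 - minValue f) * (1 - 1 / (s : ℝ)) ^ (T - s) :=
          mul_le_mul_of_nonneg_right h0 (pow_nonneg hq0 _)
      _ ≤ (f 0 - minValue f) * (δ / (f 0 - minValue f)) := by gcongr
      _ = δ := by field_simp
  · rw [failureBound, hR, Finset.univ_inter, Finset.compl_univ, Finset.card_empty,
      div_le_iff₀ (by linarith)]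
    have h1 : ((supp z).card : ℝ) ≤ sstar := by exact_mod_cast hz
    have h2 := H.sparsity
    have h3 : (3 * (ρ / ρ') + 3) * ((supp z).card : ℝ) ≤ (3 * (ρ / ρ') + 3) * sstar := by gcongr
    have h4 : (0 : ℝ) ≤ sstar * (ρ / ρ' - 1) := mul_nonneg (by positivity) (by linarith)
    push_cast
    linarith

end

/-! ### Boosting -/

section

variable {n s sstar : ℕ} {f : E n → ℝ} {ρ ρ' : ℝ} {K : Conventions n} {opt : ℝ}

theorem robustLoop_support (H : Setting f s sstar ρ ρ') {δ : ℝ} (N : ℕ) {x₀ : E n}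
    (hx₀ : IsSparse s x₀) {p : E n × ℕ} (hp : p ∈ (robustLoop K f ρ s opt δ N x₀).support) :
    IsSparse s p.1 ∧ f p.1 ≤ f x₀ ∧
      p.2 ≤ N * (⌈2 * (s : ℝ) * Real.log ((f 0 - minValue f) / δ)⌉₊ + 1) := by
  induction N generalizing x₀ p with
  | zero =>
    rw [robustLoop, PMF.mem_support_pure_iff] at hp
    subst hp
    exact ⟨hx₀, le_rfl, Nat.zero_le _⟩
  | succ N ih =>
    rw [robustLoop, PMF.mem_support_bind_iff] at hp
    obtain ⟨q, hq, hp⟩ := hp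
    rw [PMF.mem_support_map_iff] at hp
    obtain ⟨r, hr, rfl⟩ := hp
    have hcore := core_support H hq
    have hmin : IsSparse s (if f q.1 < f x₀ then q.1 else x₀) ∧
        f (if f q.1 < f x₀ then q.1 else x₀) ≤ f x₀ := by
      split_ifs with h
      · exact ⟨hcore.1, h.le⟩
      · exact ⟨hx₀, le_rfl⟩
    have hrec := ih hmin.1 hr
    refine ⟨hrec.1, hrec.2.1.trans hmin.2, ?_⟩
    rw [Nat.succ_mul]
    have := hrec.2.2
    have := hcore.2
    dsimp only
    omega

/-- The runs are independent, so their failure probabilities multiply. -/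
theorem robustLoop_failure (H : Setting f s sstar ρ ρ') {δ t : ℝ} {c : ENNReal}
    (hcore : (core K f ρ s opt δ).toOuterMeasure {p | ¬ f p.1 ≤ t} ≤ c) (N : ℕ) {x₀ : E n}
    (hx₀ : IsSparse s x₀) :
    (robustLoop K f ρ s opt δ N x₀).toOuterMeasure {p | ¬ f p.1 ≤ t} ≤ c ^ N := by
  induction N generalizing x₀ with
  | zero => simpa using toOuterMeasure_le_one _ _
  | succ N ih =>
    rw [robustLoop]
    refine (toOuterMeasure_bind_le (bad := {p | ¬ f p.1 ≤ t}) (c := c ^ N) (d := 0)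
      fun q hq => ?_).trans ?_
    · have hmin : IsSparse s (if f q.1 < f x₀ then q.1 else x₀) ∧
          f (if f q.1 < f x₀ then q.1 else x₀) ≤ f q.1 := by
        split_ifs with h
        · exact ⟨(core_support H hq).1, le_rfl⟩
        · exact ⟨hx₀, not_lt.mp h⟩
      rw [PMF.toOuterMeasure_map_apply, add_zero]
      by_cases hbad : f q.1 ≤ t
      · refine (toOuterMeasure_eq_zero fun r hr => ?_).trans_le zero_le
        have := (robustLoop_support H N hmin.1 hr).2.1
        simp only [Set.mem_preimage, Set.mem_ofPred_eq, not_not]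
        linarith [hmin.2]
      · rw [Set.indicator_of_mem (by exact hbad)]
        exact ih hmin.1
    · rw [add_zero, pow_succ]
      gcongr

theorem isSparse_zero (n s : ℕ) : IsSparse s (0 : E n) :=
  isSparse_of_supp_subset (supp_zero_subset ∅) (Nat.zero_le _)

theorem robust_support (H : Setting f s sstar ρ ρ') {δ B : ℝ} {p : E n × ℕ}
    (hp : p ∈ (robust K f ρ s opt δ B).support) :
    IsSparse s p.1 ∧ p.2 ≤ ⌈5 * Real.log (6 * (n : ℝ) * Real.log ((f 0 - B) / δ))⌉₊ *
      (⌈2 * (s : ℝ) * Real.log ((f 0 - minValue f) / δ)⌉₊ + 1) := by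
  have := robustLoop_support H _ (isSparse_zero n s) hp
  exact ⟨this.1, this.2.2⟩

/-- Repeating the core routine makes the failure probability so small that it can be summed over
the iterations of the binary search. -/
theorem robust_failure (H : Setting f s sstar ρ ρ') {z : E n} (hz : IsSparse sstar z)
    (hzopt : f z ≤ opt) (hB : minValue f ≤ opt) {δ : ℝ} (hδ : 0 < δ)
    (hD : 0 < f 0 - minValue f) (hlog : 1 ≤ Real.log ((f 0 - minValue f) / δ)) :
    (robust K f ρ s opt δ (minValue f)).toOuterMeasure {p | ¬ f p.1 ≤ opt + δ} ≤
      ENNReal.ofReal (1 / (6 * (n : ℝ) * Real.log ((f 0 - minValue f) / δ))) := by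
  have hn : (18 : ℝ) ≤ n := by exact_mod_cast H.le_s.trans H.le_dim
  refine (robustLoop_failure H (core_failure H hz hzopt hB hδ hD hlog) _
    (isSparse_zero n s)).trans ?_
  rw [← ENNReal.ofReal_pow (by norm_num)]
  refine ENNReal.ofReal_le_ofReal ?_
  set X := 6 * (n : ℝ) * Real.log ((f 0 - minValue f) / δ) with hX
  have hX1 : 1 ≤ X := by nlinarith
  set N := ⌈5 * Real.log X⌉₊
  have hN : 5 * Real.log X ≤ N := Nat.le_ceil _
  -- `2 / 3 ≤ exp (-1 / 5)`, because `(3 / 2) ^ 5 ≥ e`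
  have hexp : (2 / 3 : ℝ) ≤ Real.exp (-(1 / 5)) := by
    rw [Real.exp_neg, show (2 / 3 : ℝ) = (3 / 2)⁻¹ by norm_num]
    refine inv_anti₀ (Real.exp_pos _) ?_
    refine le_of_pow_le_pow_left₀ (n := 5) (by norm_num) (by norm_num) ?_
    rw [← Real.exp_nat_mul]
    norm_num
    linarith [Real.exp_one_lt_d9]
  calc (2 / 3 : ℝ) ^ N ≤ Real.exp (-(1 / 5)) ^ N := pow_le_pow_left₀ (by norm_num) hexp _
    _ = Real.exp (-(N / 5)) := by
        rw [← Real.exp_nat_mul]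
        congr 1
        ring
    _ ≤ Real.exp (-Real.log X) := by
        rw [Real.exp_le_exp]
        linarith
    _ = 1 / X := by rw [Real.exp_neg, Real.exp_log (by linarith), one_div]

/-! ### Binary search -/

theorem gapMeasure_pos {ε L : ℝ} (hε : 0 < ε) (hL : ε < L) : 0 < gapMeasure ε L :=
  (Nat.zero_le _).trans_lt (gapMeasure_lt hε hL (L' := 0) (by linarith))

theorem searchLoop_support {ε : ℝ} (hε : 0 < ε) {B : ℝ} {M : ℕ}
    (hrobust : ∀ opt, ∀ p ∈ (robust K f ρ s opt (ε / 3) B).support, IsSparse s p.1 ∧ p.2 ≤ M)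
    (N : ℕ) {l r : ℝ} {b : E n} (hN : gapMeasure ε (r - l) ≤ N) (hb : IsSparse s b)
    {p : E n × ℕ} (hp : p ∈ (searchLoop K f ρ s ε hε B l r b).support) :
    IsSparse s p.1 ∧ p.2 ≤ N * (M + 1) := by
  induction N generalizing l r b p with
  | zero =>
    have hgap : ¬ r - l > ε := fun h => by
      have := gapMeasure_pos hε h
      omega
    rw [searchLoop, dif_neg hgap, PMF.mem_support_pure_iff] at hp
    subst hp
    exact ⟨hb, Nat.zero_le _⟩
  | succ N ih =>
    rw [searchLoop] at hp
    split_ifs at hp with hgap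
    · rw [PMF.mem_support_bind_iff] at hp
      obtain ⟨q, hq, hp⟩ := hp
      have hqM := hrobust _ q hq
      rw [Nat.succ_mul]
      split_ifs at hp with hx
      all_goals
        rw [PMF.mem_support_map_iff] at hp
        obtain ⟨p', hp', rfl⟩ := hp
      · have hlt := gapMeasure_lt (L' := r - (l + r) / 2) hε hgap (by linarith)
        have := ih (by omega) hb hp'
        exact ⟨this.1, by dsimp only; omega⟩
      · have hlt := gapMeasure_lt (L' := f q.1 - l) hε hgap (by linarith)
        have := ih (by omega) hqM.1 hp'
        exact ⟨this.1, by dsimp only; omega⟩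
    · rw [PMF.mem_support_pure_iff] at hp
      subst hp
      exact ⟨hb, Nat.zero_le _⟩

/-- As long as no call with a target of at least `f z` fails, the lower end of the bracket stays
below `f z`; only such calls enter the union bound. -/
theorem searchLoop_failure {ε : ℝ} (hε : 0 < ε) {B t : ℝ} {c : ENNReal}
    (hrobust : ∀ opt, B ≤ opt → t ≤ opt →
      (robust K f ρ s opt (ε / 3) B).toOuterMeasure {p | ¬ f p.1 ≤ opt + ε / 3} ≤ c)
    (N : ℕ) {l r : ℝ} {b : E n} (hN : gapMeasure ε (r - l) ≤ N) (hB : B ≤ l) (hl : l ≤ t)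
    (hb : f b = r) :
    (searchLoop K f ρ s ε hε B l r b).toOuterMeasure {p | ¬ f p.1 ≤ t + ε} ≤ N * c := by
  induction N generalizing l r b with
  | zero =>
    have hgap : ¬ r - l > ε := fun h => by
      have := gapMeasure_pos hε h
      omega
    rw [searchLoop, dif_neg hgap]
    refine (toOuterMeasure_eq_zero fun p hp => ?_).trans_le zero_le
    rw [PMF.mem_support_pure_iff] at hp
    subst hp
    simp only [Set.mem_ofPred_eq, not_not]
    linarith
  | succ N ih =>
    rw [searchLoop]
    split_ifs with hgap
    · have hup : ∀ p : E n × ℕ, f p.1 ≤ (l + r) / 2 + ε / 3 →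
          (searchLoop K f ρ s ε hε B l (f p.1) p.1).toOuterMeasure {p | ¬ f p.1 ≤ t + ε} ≤
            N * c := by
        intro p hx
        have hlt := gapMeasure_lt (L' := f p.1 - l) hε hgap (by linarith)
        exact ih (by omega) hB hl rfl
      have hmap : ∀ (k : ℕ) (μ : PMF (E n × ℕ)),
          (μ.map fun q => (q.1, k + 1 + q.2)).toOuterMeasure {p | ¬ f p.1 ≤ t + ε} =
            μ.toOuterMeasure {p | ¬ f p.1 ≤ t + ε} := by
        intro k μ
        rw [PMF.toOuterMeasure_map_apply]
        rfl
      -- for a target below `t` both outcomes preserve the invariant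
      by_cases ht : t ≤ (l + r) / 2
      · refine (toOuterMeasure_bind_le (bad := {p | ¬ f p.1 ≤ (l + r) / 2 + ε / 3}) (c := 1)
          (d := N * c) fun p _ => ?_).trans ?_
        · split_ifs with hx
          · rw [Set.indicator_of_mem (by exact not_le.mpr hx)]
            exact (toOuterMeasure_le_one _ _).trans le_self_add
          · rw [hmap]
            exact (hup p (not_lt.mp hx)).trans le_add_self
        · rw [Nat.cast_succ, add_mul, one_mul, one_mul, add_comm]
          gcongr
          exact hrobust _ (by linarith) ht
      · refine (toOuterMeasure_bind_le (bad := ∅) (c := 0) (d := N * c) fun p _ => ?_).trans ?_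
        · rw [Set.indicator_empty, zero_add]
          split_ifs with hx
          · rw [hmap]
            have hlt := gapMeasure_lt (L' := r - (l + r) / 2) hε hgap (by linarith)
            exact ih (by omega) (by linarith) (by linarith) hb
          · rw [hmap]
            exact hup p (not_lt.mp hx)
        · rw [zero_mul, zero_add]
          gcongr
          omega
    · refine (toOuterMeasure_eq_zero fun p hp => ?_).trans_le zero_le
      rw [PMF.mem_support_pure_iff] at hp
      subst hp
      simp only [Set.mem_ofPred_eq, not_not]
      linarith

/-! ### Adaptively regularized hard thresholding -/

theorem gapMeasure_le {ε D : ℝ} (hε : 0 < ε) (hD : ε < D) :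
    (gapMeasure ε D : ℝ) ≤ 6 * Real.log (D / ε) + 1 := by
  have h1 : 1 < D / ε := (one_lt_div hε).mpr hD
  have hlog : 0 < Real.log (D / ε) := Real.log_pos h1
  have h65 : (1 / 6 : ℝ) ≤ Real.log (6 / 5) := by
    have := Real.one_sub_inv_le_log_of_pos (show (0 : ℝ) < 6 / 5 by norm_num)
    norm_num at this ⊢
    linarith
  unfold gapMeasure
  rw [max_eq_left h1.le]
  refine (Nat.ceil_lt_add_one (Real.logb_pos (by norm_num) h1).le).le.trans ?_
  have : Real.logb (6 / 5) (D / ε) ≤ 6 * Real.log (D / ε) := by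
    rw [Real.logb, div_le_iff₀ (by linarith)]
    nlinarith
  linarith

theorem log_three_bounds : (1 : ℝ) ≤ Real.log 3 ∧ Real.log 3 ≤ 2 := by
  constructor
  · rw [Real.le_log_iff_exp_le (by norm_num)]
    linarith [Real.exp_one_lt_d9]
  · have := Real.log_le_sub_one_of_pos (show (0 : ℝ) < 3 by norm_num)
    linarith

theorem log_div_third {ε D : ℝ} (hε : 0 < ε) (hD : 0 < D) :
    Real.log (D / (ε / 3)) = Real.log 3 + Real.log (D / ε) := by
  rw [← Real.log_mul (by norm_num) (by positivity)]
  congr 1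
  field_simp

/-- If `f 0` is already within `ε` of the infimum, then the binary search returns at once. -/
theorem arht_eq_pure {ε : ℝ} (hε : 0 < ε) (h : f 0 - minValue f ≤ ε) :
    arht K f ρ s ε hε = PMF.pure (0, 0) := by
  rw [arht, searchLoop, dif_neg (not_lt.mpr h)]

theorem arht_isSparse (H : Setting f s sstar ρ ρ') {ε : ℝ} (hε : 0 < ε) {p : E n × ℕ}
    (hp : p ∈ (arht K f ρ s ε hε).support) : IsSparse s p.1 :=
  (searchLoop_support hε (fun _ _ hq => robust_support H hq) _ le_rfl (isSparse_zero n s) hp).1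

theorem arht_failure (H : Setting f s sstar ρ ρ') (hbdd : BddBelow (Set.range f)) {ε : ℝ}
    (hε : 0 < ε) {z : E n} (hz : IsSparse sstar z) :
    (arht K f ρ s ε hε).toOuterMeasure {p | ¬ f p.1 ≤ f z + ε} ≤ ENNReal.ofReal (1 / n) := by
  have hBz : minValue f ≤ f z := ciInf_le hbdd z
  by_cases hD : f 0 - minValue f ≤ ε
  · rw [arht_eq_pure hε hD]
    refine (toOuterMeasure_eq_zero fun p hp => ?_).trans_le zero_le
    rw [PMF.mem_support_pure_iff] at hp
    subst hp
    simp only [Set.mem_ofPred_eq, not_not]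
    linarith
  rw [not_le] at hD
  have hn : (18 : ℝ) ≤ n := by exact_mod_cast H.le_s.trans H.le_dim
  have hlog : 0 < Real.log ((f 0 - minValue f) / ε) := Real.log_pos ((one_lt_div hε).mpr hD)
  have h3 := log_three_bounds.1
  have hlog3 := log_div_third hε (hε.trans hD)
  refine (searchLoop_failure hε (fun opt hB hopt => robust_failure H hz hopt hB (by positivity)
    (hε.trans hD) (by linarith)) _ le_rfl le_rfl hBz rfl).trans ?_
  rw [← ENNReal.ofReal_natCast, ← ENNReal.ofReal_mul (by positivity)]
  refine ENNReal.ofReal_le_ofReal ?_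
  have hN := gapMeasure_le hε hD
  rw [hlog3, mul_one_div, div_le_div_iff₀ (by positivity) (by positivity)]
  nlinarith

theorem le_arht_success (H : Setting f s sstar ρ ρ') (hbdd : BddBelow (Set.range f)) {ε : ℝ}
    (hε : 0 < ε) {z : E n} (hz : IsSparse sstar z) :
    ENNReal.ofReal (1 - 1 / (n : ℝ)) ≤ (arht K f ρ s ε hε).toOuterMeasure
      {p : E n × ℕ | IsSparse s p.1 ∧ f p.1 ≤ f z + ε} := by
  set μ := arht K f ρ s ε hε
  have h1 : (1 : ENNReal) ≤ μ.toOuterMeasure {p | IsSparse s p.1 ∧ f p.1 ≤ f z + ε} +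
      μ.toOuterMeasure {p | ¬ f p.1 ≤ f z + ε} := by
    rw [← (μ.toOuterMeasure_apply_eq_one_iff ({p | IsSparse s p.1 ∧ f p.1 ≤ f z + ε} ∪
      {p | ¬ f p.1 ≤ f z + ε})).mpr]
    · exact MeasureTheory.measure_union_le _ _
    · intro p hp
      by_cases h : f p.1 ≤ f z + ε
      · exact Or.inl ⟨arht_isSparse H hε hp, h⟩
      · exact Or.inr h
  rw [ENNReal.ofReal_sub _ (by positivity), ENNReal.ofReal_one, tsub_le_iff_right]
  exact h1.trans (by gcongr; exact arht_failure H hbdd hε hz)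

theorem arht_iterations_le (H : Setting f s sstar ρ ρ') {ε : ℝ} (hε : 0 < ε) {p : E n × ℕ}
    (hp : p ∈ (arht K f ρ s ε hε).support) :
    (p.2 : ℝ) ≤ 1000 * ((s : ℝ) * (max 1 (Real.log ((f 0 - minValue f) / ε))) ^ 2 *
      Real.log ((n : ℝ) * max 1 (Real.log ((f 0 - minValue f) / ε)))) := by
  have hs : (18 : ℝ) ≤ s := by exact_mod_cast H.le_s
  have hn : (18 : ℝ) ≤ n := by exact_mod_cast H.le_s.trans H.le_dim
  set L := max 1 (Real.log ((f 0 - minValue f) / ε)) with hL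
  have hL1 : 1 ≤ L := le_max_left _ _
  have hnL : 18 ≤ n * L := by nlinarith
  have hY1 : 1 ≤ Real.log (n * L) :=
    log_three_bounds.1.trans (Real.log_le_log (by norm_num) (by linarith))
  by_cases hD : f 0 - minValue f ≤ ε
  · rw [arht_eq_pure hε hD, PMF.mem_support_pure_iff] at hp
    subst hp
    simp only [Nat.cast_zero]
    positivity
  rw [not_le] at hD
  have hlog : 0 < Real.log ((f 0 - minValue f) / ε) := Real.log_pos ((one_lt_div hε).mpr hD)
  have hlogL : Real.log ((f 0 - minValue f) / ε) ≤ L := le_max_right _ _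
  have h3 := log_three_bounds
  have hlog3 := log_div_third hε (hε.trans hD)
  have hp2 := (searchLoop_support hε (fun _ _ hq => robust_support H hq) _ le_rfl
    (isSparse_zero n s) hp).2
  have hN := gapMeasure_le hε hD
  rw [hlog3] at hp2
  set T := ⌈2 * (s : ℝ) * (Real.log 3 + Real.log ((f 0 - minValue f) / ε))⌉₊
  set Z := ⌈5 * Real.log (6 * (n : ℝ) * (Real.log 3 + Real.log ((f 0 - minValue f) / ε)))⌉₊
  set N := gapMeasure ε (f 0 - minValue f)
  have hp3 : (p.2 : ℝ) ≤ N * (Z * (T + 1) + 1) := by exact_mod_cast hp2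
  have hsL : 1 ≤ s * L := by nlinarith
  have hT : (T : ℝ) + 1 ≤ 8 * (s * L) := by
    have h1 : (T : ℝ) < _ := Nat.ceil_lt_add_one (by positivity)
    have h2 : 2 * (s : ℝ) * (Real.log 3 + Real.log ((f 0 - minValue f) / ε)) ≤
        2 * s * (3 * L) := by
      gcongr
      linarith
    linarith
  have hZ : (Z : ℝ) ≤ 11 * Real.log (n * L) := by
    have hX : 1 ≤ 6 * (n : ℝ) * (Real.log 3 + Real.log ((f 0 - minValue f) / ε)) := by nlinarith
    have h1 : (Z : ℝ) < _ := Nat.ceil_lt_add_one (by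
      have := Real.log_nonneg hX
      positivity)
    have h2 : Real.log (6 * (n : ℝ) * (Real.log 3 + Real.log ((f 0 - minValue f) / ε))) ≤
        2 * Real.log (n * L) := by
      have hnL0 : (n : ℝ) * L ≠ 0 := by positivity
      rw [two_mul, ← Real.log_mul hnL0 hnL0]
      refine Real.log_le_log (by linarith) ?_
      calc 6 * (n : ℝ) * (Real.log 3 + Real.log ((f 0 - minValue f) / ε))
          ≤ 6 * n * (3 * L) := by gcongr; linarith
        _ = 18 * (n * L) := by ring
        _ ≤ _ := by gcongr
    linarith
  calc (p.2 : ℝ) ≤ N * (Z * (T + 1) + 1) := hp3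
    _ ≤ (7 * L) * ((11 * Real.log (n * L)) * (8 * (s * L)) + 1 * 1) := by
        gcongr
        · linarith
        · norm_num
    _ ≤ (7 * L) * ((11 * Real.log (n * L)) * (8 * (s * L)) + Real.log (n * L) * (s * L)) := by
        gcongr
    _ = 623 * (s * L ^ 2 * Real.log (n * L)) := by ring
    _ ≤ 1000 * (s * L ^ 2 * Real.log (n * L)) := by
        gcongr
        norm_num

/-- Comparing the two quadratic bounds along a coordinate direction. -/
theorem RestrictedStronglyConvex.le_of_restrictedSmooth {n t : ℕ} {f : E n → ℝ} {ρ ρ' : ℝ}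
    (hconv : RestrictedStronglyConvex f t ρ') (hsm : RestrictedSmooth f 2 ρ) (ht : 1 ≤ t)
    (i : Fin n) : ρ' ≤ ρ := by
  have hsp : supp (EuclideanSpace.single i (1 : ℝ) - 0 : E n) ⊆ {i} :=
    supp_subset_iff.mpr fun k hk => by simpa using hk
  have h1 := hconv 0 (EuclideanSpace.single i 1)
    (isSparse_of_supp_subset hsp (by simpa using ht))
  have h2 := hsm 0 (EuclideanSpace.single i 1) (isSparse_of_supp_subset hsp (by simp))
  have h3 : ‖(EuclideanSpace.single i (1 : ℝ) - 0 : E n)‖ = 1 := by simp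
  rw [h3] at h1 h2
  linarith

/-- The smoothness constant could not be the least one if there were no coordinates. -/
theorem IsRSSConstant.dim_pos {n t : ℕ} {f : E n → ℝ} {ρ : ℝ} (h : IsRSSConstant f t ρ) :
    0 < n := by
  rcases Nat.eq_zero_or_pos n with rfl | hn
  · have : ρ ≤ ρ - 1 := h.2 fun x y _ => by
      rw [Subsingleton.elim y x]
      simp
    linarith
  · exact hn

end

end ARHT

end

theorem theorem1 :
    ∃ C : ℝ, 0 < C ∧
      ∀ (n s sstar : ℕ) (f : ARHT.E n → ℝ) (ρplus ρminus ε : ℝ) (K : ARHT.Conventions n)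
        (hε : 0 < ε),
        Differentiable ℝ f →
        BddBelow (Set.range f) →
        ARHT.IsRSSConstant f 2 ρplus →
        ARHT.IsRSCConstant f (s + sstar) ρminus →
        0 < ρminus →
        1 ≤ sstar →
        s ≤ n →
        (sstar : ℝ) * max (4 * (ρplus / ρminus) + 7) (12 * (ρplus / ρminus) + 6) ≤ (s : ℝ) →
        (∀ xstar : ARHT.E n, ARHT.IsSparse sstar xstar →
          ENNReal.ofReal (1 - 1 / (n : ℝ)) ≤
            (ARHT.arht K f ρplus s ε hε).toOuterMeasure
              {p : ARHT.E n × ℕ | ARHT.IsSparse s p.1 ∧ f p.1 ≤ f xstar + ε}) ∧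
        (∀ p ∈ (ARHT.arht K f ρplus s ε hε).support,
          (p.2 : ℝ) ≤
            C * ((s : ℝ) * (max 1 (Real.log ((f 0 - ⨅ x, f x) / ε))) ^ 2 *
              Real.log ((n : ℝ) * max 1 (Real.log ((f 0 - ⨅ x, f x) / ε))))) := by
  refine ⟨1000, by norm_num, ?_⟩
  intro n s sstar f ρplus ρminus ε K hε hf hbdd hsm hconv hpos hstar hsn hs
  have H : ARHT.Setting f s sstar ρplus ρminus :=
    { differentiable := hf
      smooth := hsm.1
      convex := hconv.1.2
      pos := hpos
      le := hconv.1.2.le_of_restrictedSmooth hsm.1 (hstar.trans (Nat.le_add_left _ _))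
        ⟨0, hsm.dim_pos⟩
      one_le_sstar := hstar
      sparsity := (mul_le_mul_of_nonneg_left (le_max_right _ _) (Nat.cast_nonneg _)).trans hs
      le_dim := hsn }
  exact ⟨fun z hz => ARHT.le_arht_success H hbdd hε hz,
    fun p hp => ARHT.arht_iterations_le H hε hp⟩
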